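/- Let $(M^2,g)$ be a connected smooth Riemannian surface, let $(N^3,h)$ be a smooth Riemannian $3$-manifold, and let $\varphi:(M^2,g)\to(N^3,h)$ be a totally umbilical isometric immersion with smooth unit normal vector field $\xi$ along $\varphi$ and mean curvature vector field $\eta=\tfrac12\,\mathrm{Trace}_g\nabla d\varphi=H\xi$; thus $\nabla d\varphi = g\otimes\eta$. Let $A$, $AX=-(\nabla^\varphi_X\xi)^\top$, be the shape operator, let $|A|$ be its norm with respect to $g$, let $\mathrm{Ric}^N$ denote both the Ricci tensor and the Ricci operator of $(N,h)$, so that $\langle \mathrm{Ric}^N(Z),W\rangle=\mathrm{Ric}^N(Z,W)$, and let $(\cdot)^\top$ denote the component tangent to the surface, regarded as a tangent vector of $M$. Let $f:M\to(0,\infty)$ be a smooth function. A smooth map $\psi$ from a Riemannian manifold to $(N,h)$ with tension field $\tau(\psi)=\mathrm{Trace}\,\nabla d\psi$ is called biharmonic if $$\tau_2(\psi)=\mathrm{Trace}\bigl(\nabla^{\psi}\nabla^{\psi}-\nabla^{\psi}_{\nabla}\bigr)\tau(\psi)-\mathrm{Trace}\,R^N(d\psi,\tau(\psi))d\psi=0,$$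 where $\nabla$ is the Levi-Civita connection and the trace is taken with respect to the metric of the domain, $\nabla^\psi$ is the connection induced on vector fields along $\psi$, and $R^N(X,Y)=[\nabla^N_X,\nabla^N_Y]-\nabla^N_{[X,Y]}$. Then: 1. The conformal immersion $\varphi:(M^2,f^{-1}g)\to(N^3,h)$ is biharmonic if and only if one of the following holds: (i) the surface $\varphi:(M^2,g)\to(N^3,h)$ is totally geodesic, that is, $\nabla d\varphi=0$; (ii) $H$ vanishes nowhere on $M$, and on $M$ $$(\mathrm{Ric}^N(\xi))^\top=\mathrm{grad}_g H,\qquad \mathrm{Ric}^N(\xi,\xi)=|A|^2=2H^2,\qquad \mathrm{grad}_g(fH)=0.$$ 2. In case (ii) there is a constant $c>0$ with $f=c\,|H|^{-1}$ on $M$. 3. The equation $(\mathrm{Ric}^N(\xi))^\top=\mathrm{grad}_g H$ holds on every totally umbilical surface as above, whether or not the conformal immersion is biharmonic. -/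

import Mathlib

set_option maxSynthPendingDepth 3

open scoped Manifold ContDiff

noncomputable section

namespace BiharmonicSurface

/-! ### Tensor calculus on open subsets of Euclidean space

A metric on an open set is a map `G : 𝔼 n → (𝔼 n →L[ℝ] 𝔼 n →L[ℝ] ℝ)`; all formulas below are
evaluated only at points of an open set on which `G` is smooth, symmetric and positive definite. -/

/-- Euclidean space of dimension `n`. -/
abbrev 𝔼 (n : ℕ) : Type := EuclideanSpace ℝ (Fin n)

/-- The `i`-th standard basis vector. -/
def basisVec {n : ℕ} (i : Fin n) : 𝔼 n := EuclideanSpace.single i (1 : ℝ)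

/-- The `i`-th coordinate as a covector. -/
def coordForm {n : ℕ} (i : Fin n) : 𝔼 n →L[ℝ] ℝ := EuclideanSpace.proj i

/-- Trace of a bilinear map `c` with respect to an inner product `b`: the sum of
`b^{ij} c(e_i, e_j)`, where `(b^{ij})` is the inverse of the Gram matrix of `b`.
Here `b.inverse` is the musical isomorphism from covectors to vectors. -/
def metricTrace {n : ℕ} {W : Type*} [AddCommGroup W] [Module ℝ W]
    (b : 𝔼 n →L[ℝ] 𝔼 n →L[ℝ] ℝ) (c : 𝔼 n → 𝔼 n → W) : W :=
  ∑ i : Fin n, ∑ j : Fin n, coordForm i (b.inverse (coordForm j)) • c (basisVec i) (basisVec j)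

/-- Christoffel symbols of the first kind:
`(u, v, w) ↦ (1/2) (D_u G(v, w) + D_v G(u, w) - D_w G(u, v))`. -/
def christoffelFirst {n : ℕ} (G : 𝔼 n → (𝔼 n →L[ℝ] 𝔼 n →L[ℝ] ℝ)) (x : 𝔼 n) :
    𝔼 n →L[ℝ] 𝔼 n →L[ℝ] 𝔼 n →L[ℝ] ℝ :=
  let D : 𝔼 n →L[ℝ] 𝔼 n →L[ℝ] 𝔼 n →L[ℝ] ℝ := fderiv ℝ G x
  let S : 𝔼 n →L[ℝ] 𝔼 n →L[ℝ] 𝔼 n →L[ℝ] ℝ :=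
    ((ContinuousLinearMap.flipₗᵢ ℝ (𝔼 n) (𝔼 n) ℝ).toContinuousLinearEquiv :
      (𝔼 n →L[ℝ] 𝔼 n →L[ℝ] ℝ) →L[ℝ] (𝔼 n →L[ℝ] 𝔼 n →L[ℝ] ℝ)).comp D.flip
  (1 / 2 : ℝ) • (D + D.flip - S)

/-- The formula for `christoffelFirst` on vectors. -/
theorem christoffelFirst_apply {n : ℕ} (G : 𝔼 n → (𝔼 n →L[ℝ] 𝔼 n →L[ℝ] ℝ)) (x u v w : 𝔼 n) :
    christoffelFirst G x u v w =
      (1 / 2 : ℝ) * (fderiv ℝ G x u v w + fderiv ℝ G x v u w - fderiv ℝ G x w u v) := by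
  simp [christoffelFirst]

/-- Christoffel symbols of the second kind, i.e. the Levi-Civita connection of `G`:
`christoffel G x u v = ∇_u v` at `x` for constant vector fields `u`, `v`. -/
def christoffel {n : ℕ} (G : 𝔼 n → (𝔼 n →L[ℝ] 𝔼 n →L[ℝ] ℝ)) (x : 𝔼 n) :
    𝔼 n →L[ℝ] 𝔼 n →L[ℝ] 𝔼 n :=
  (ContinuousLinearMap.compL ℝ (𝔼 n) (𝔼 n →L[ℝ] ℝ) (𝔼 n) (G x).inverse).comp
    (christoffelFirst G x)

/-- The formula for `christoffel` on vectors. -/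
theorem christoffel_apply {n : ℕ} (G : 𝔼 n → (𝔼 n →L[ℝ] 𝔼 n →L[ℝ] ℝ)) (x u v : 𝔼 n) :
    christoffel G x u v = (G x).inverse (christoffelFirst G x u v) := rfl

/-- Curvature operator `R(u, v) = [∇_u, ∇_v] - ∇_{[u, v]}`. -/
def curvature {n : ℕ} (G : 𝔼 n → (𝔼 n →L[ℝ] 𝔼 n →L[ℝ] ℝ)) (x u v : 𝔼 n) : 𝔼 n →L[ℝ] 𝔼 n :=
  fderiv ℝ (christoffel G) x u v - fderiv ℝ (christoffel G) x v u
    + (christoffel G x u).comp (christoffel G x v) - (christoffel G x v).comp (christoffel G x u)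

/-- Ricci tensor `Ric(v, w) = trace (u ↦ R(u, v) w)`, as a covector in `w`. -/
def ricciForm {n : ℕ} (G : 𝔼 n → (𝔼 n →L[ℝ] 𝔼 n →L[ℝ] ℝ)) (x v : 𝔼 n) : 𝔼 n →L[ℝ] ℝ :=
  ∑ i : Fin n, (coordForm i).comp (curvature G x (basisVec i) v)

/-- Covariant derivative `∇^φ_u V` at `x` of a vector field `V` along `φ`, for the Levi-Civita
connection of the metric `K` on the target. -/
def covDeriv {m n : ℕ} (K : 𝔼 n → (𝔼 n →L[ℝ] 𝔼 n →L[ℝ] ℝ)) (φ V : 𝔼 m → 𝔼 n) (x u : 𝔼 m) :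
    𝔼 n :=
  fderiv ℝ V x u + christoffel K (φ x) (fderiv ℝ φ x u) (V x)

/-- Second fundamental form `(∇dφ)(u, v) = ∇^φ_u (dφ v) - dφ (∇_u v)` of a map `φ`. -/
def secondFund {m n : ℕ} (G : 𝔼 m → (𝔼 m →L[ℝ] 𝔼 m →L[ℝ] ℝ))
    (K : 𝔼 n → (𝔼 n →L[ℝ] 𝔼 n →L[ℝ] ℝ)) (φ : 𝔼 m → 𝔼 n) (x u v : 𝔼 m) : 𝔼 n :=
  covDeriv K φ (fun y => fderiv ℝ φ y v) x u - fderiv ℝ φ x (christoffel G x u v)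

/-- Tension field `τ(φ) = Trace ∇dφ`. -/
def tension {m n : ℕ} (G : 𝔼 m → (𝔼 m →L[ℝ] 𝔼 m →L[ℝ] ℝ))
    (K : 𝔼 n → (𝔼 n →L[ℝ] 𝔼 n →L[ℝ] ℝ)) (φ : 𝔼 m → 𝔼 n) (x : 𝔼 m) : 𝔼 n :=
  metricTrace (G x) (secondFund G K φ x)

/-- `(∇^φ ∇^φ - ∇^φ_{∇}) V` evaluated on `(u, v)`. -/
def covDeriv₂ {m n : ℕ} (G : 𝔼 m → (𝔼 m →L[ℝ] 𝔼 m →L[ℝ] ℝ))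
    (K : 𝔼 n → (𝔼 n →L[ℝ] 𝔼 n →L[ℝ] ℝ)) (φ V : 𝔼 m → 𝔼 n) (x u v : 𝔼 m) : 𝔼 n :=
  covDeriv K φ (fun y => covDeriv K φ V y v) x u - covDeriv K φ V x (christoffel G x u v)

/-- Bitension field
`τ₂(φ) = Trace (∇^φ ∇^φ - ∇^φ_{∇}) τ(φ) - Trace R(dφ, τ(φ)) dφ`. -/
def bitension {m n : ℕ} (G : 𝔼 m → (𝔼 m →L[ℝ] 𝔼 m →L[ℝ] ℝ))
    (K : 𝔼 n → (𝔼 n →L[ℝ] 𝔼 n →L[ℝ] ℝ)) (φ : 𝔼 m → 𝔼 n) (x : 𝔼 m) : 𝔼 n :=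
  metricTrace (G x) (covDeriv₂ G K φ (tension G K φ) x)
    - metricTrace (G x) (fun u v =>
        curvature K (φ x) (fderiv ℝ φ x u) (tension G K φ x) (fderiv ℝ φ x v))

/-! ### Riemannian manifolds -/

/-- Smooth Riemannian metrics on the `n`-dimensional manifold `M`. -/
abbrev RMetric (n : ℕ) (M : Type*) [TopologicalSpace M] [ChartedSpace (𝔼 n) M]
    [IsManifold (𝓡 n) ∞ M] : Type _ :=
  Bundle.ContMDiffRiemannianMetric (𝓡 n) ∞ (𝔼 n) (fun p : M => TangentSpace (𝓡 n) p)

section Manifolds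

variable {m n : ℕ} {M N : Type*}
  [TopologicalSpace M] [ChartedSpace (𝔼 m) M] [IsManifold (𝓡 m) ∞ M]
  [TopologicalSpace N] [ChartedSpace (𝔼 n) N] [IsManifold (𝓡 n) ∞ N]

/-- Differential of the coordinate map `e` at `p`. -/
def dChart (e : OpenPartialHomeomorph M (𝔼 m)) (p : M) : TangentSpace (𝓡 m) p →L[ℝ] 𝔼 m :=
  mfderiv (𝓡 m) (𝓡 m) e p

/-- Differential of the inverse `e.symm` of the coordinate map at `x`. -/
def dChartSymm (e : OpenPartialHomeomorph M (𝔼 m)) (x : 𝔼 m) :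
    𝔼 m →L[ℝ] TangentSpace (𝓡 m) (e.symm x) :=
  mfderiv (𝓡 m) (𝓡 m) e.symm x

/-- The metric `g` at `p`, as a bilinear form on `𝔼 m`, the model of the tangent space. -/
def metricAt (g : RMetric m M) (p : M) : 𝔼 m →L[ℝ] 𝔼 m →L[ℝ] ℝ := g.inner p

/-- The metric `g` in the local coordinates `e`: `(u, v) ↦ g(d(e⁻¹) u, d(e⁻¹) v)`. -/
def metricIn (g : RMetric m M) (e : OpenPartialHomeomorph M (𝔼 m)) (x : 𝔼 m) :
    𝔼 m →L[ℝ] 𝔼 m →L[ℝ] ℝ :=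
  (metricAt g (e.symm x)).bilinearComp (dChartSymm e x) (dChartSymm e x)

/-- The map `φ` in the local coordinates `e` and `e'`. -/
def mapIn (φ : M → N) (e : OpenPartialHomeomorph M (𝔼 m)) (e' : OpenPartialHomeomorph N (𝔼 n)) :
    𝔼 m → 𝔼 n :=
  fun x => e' (φ (e.symm x))

/-- The vector field `V` along `φ` in the local coordinates `e` and `e'`. -/
def fieldIn {φ : M → N} (V : ∀ p : M, TangentSpace (𝓡 n) (φ p))
    (e : OpenPartialHomeomorph M (𝔼 m)) (e' : OpenPartialHomeomorph N (𝔼 n)) : 𝔼 m → 𝔼 n :=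
  fun x => dChart e' (φ (e.symm x)) (V (e.symm x))

/-- The gradient of `u : M → ℝ`. -/
def grad (g : RMetric m M) (u : M → ℝ) (p : M) : TangentSpace (𝓡 m) p :=
  (g.inner p).inverse (mfderiv (𝓡 m) 𝓘(ℝ, ℝ) u p)

/-- The Ricci tensor `Ric(Z, ·)` at `q`. -/
def ricci (h : RMetric n N) (q : N) (Z : TangentSpace (𝓡 n) q) : TangentSpace (𝓡 n) q →L[ℝ] ℝ :=
  (ricciForm (metricIn h (chartAt (𝔼 n) q)) (chartAt (𝔼 n) q q)
    (dChart (chartAt (𝔼 n) q) q Z)).comp (dChart (chartAt (𝔼 n) q) q)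

/-- The Ricci operator, `⟨Ric(Z), W⟩ = Ric(Z, W)`. -/
def ricciOp (h : RMetric n N) (q : N) (Z : TangentSpace (𝓡 n) q) : TangentSpace (𝓡 n) q :=
  (h.inner q).inverse (ricci h q Z)

/-- The conformally related metric `f⁻¹ g`. -/
def conformalMetric (g : RMetric m M) (f : M → ℝ) (hf : ContMDiff (𝓡 m) 𝓘(ℝ, ℝ) ∞ f)
    (hpos : ∀ p, 0 < f p) : RMetric m M where
  inner p := (f p)⁻¹ • g.inner p
  symm p v w := by
    show (f p)⁻¹ * g.inner p v w = (f p)⁻¹ * g.inner p w v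
    rw [g.symm]
  pos p v hv := mul_pos (inv_pos.mpr (hpos p)) (g.pos p v hv)
  isVonNBounded p := by
    have hs : 0 < Real.sqrt (f p) := Real.sqrt_pos.mpr (hpos p)
    refine ((g.isVonNBounded p).image
      (Real.sqrt (f p) • ContinuousLinearMap.id ℝ (TangentSpace (𝓡 m) p))).subset ?_
    intro v hv
    have hv' : (f p)⁻¹ * g.inner p v v < 1 := hv
    refine ⟨(Real.sqrt (f p))⁻¹ • v, ?_, ?_⟩
    · show g.inner p ((Real.sqrt (f p))⁻¹ • v) ((Real.sqrt (f p))⁻¹ • v) < 1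
      have hsq : (Real.sqrt (f p))⁻¹ * (Real.sqrt (f p))⁻¹ = (f p)⁻¹ := by
        rw [← mul_inv, Real.mul_self_sqrt (hpos p).le]
      rw [map_smul, map_smul, smul_apply, smul_eq_mul, smul_eq_mul,
        ← mul_assoc, hsq]
      exact hv'
    · show Real.sqrt (f p) • ((Real.sqrt (f p))⁻¹ • v) = v
      rw [smul_smul, mul_inv_cancel₀ hs.ne', one_smul]
  contMDiff := by
    have hfi : ContMDiff (𝓡 m) 𝓘(ℝ, ℝ) ∞ (fun p => (f p)⁻¹) := by
      intro p
      exact (hf p).inv₀ (hpos p).ne'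
    exact hfi.smul_section g.contMDiff

/-- `φ : (M, g) → (N, h)` is a (smooth) isometric immersion. -/
def IsIsometricImmersion (g : RMetric m M) (h : RMetric n N) (φ : M → N) : Prop :=
  ContMDiff (𝓡 m) (𝓡 n) ∞ φ ∧
    ∀ (p : M) (X Y : TangentSpace (𝓡 m) p),
      h.inner (φ p) (mfderiv (𝓡 m) (𝓡 n) φ p X) (mfderiv (𝓡 m) (𝓡 n) φ p Y) = g.inner p X Y

variable (m) in
/-- `ξ` is a smooth unit normal vector field along `φ`. -/
def IsUnitNormal (h : RMetric n N) (φ : M → N)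
    (ξ : ∀ p : M, TangentSpace (𝓡 n) (φ p)) : Prop :=
  ContMDiff (𝓡 m) (𝓡 n).tangent ∞ (fun p => (⟨φ p, ξ p⟩ : TangentBundle (𝓡 n) N)) ∧
    (∀ p, h.inner (φ p) (ξ p) (ξ p) = 1) ∧
    ∀ (p : M) (X : TangentSpace (𝓡 m) p),
      h.inner (φ p) (mfderiv (𝓡 m) (𝓡 n) φ p X) (ξ p) = 0

/-- `φ : (M, g) → (N, h)` is totally geodesic: its second fundamental form vanishes. -/
def IsTotallyGeodesic (g : RMetric m M) (h : RMetric n N) (φ : M → N) : Prop :=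
  ∀ e ∈ atlas (𝔼 m) M, ∀ e' ∈ atlas (𝔼 n) N, ∀ p ∈ e.source, φ p ∈ e'.source →
    ∀ u v : 𝔼 m, secondFund (metricIn g e) (metricIn h e') (mapIn φ e e') (e p) u v = 0

/-- The isometric immersion `φ : (M, g) → (N, h)` is totally umbilical: its second fundamental form
is `g ⊗ η`, where `η = (1/m) Trace ∇dφ` is the mean curvature vector field. -/
def IsTotallyUmbilical (g : RMetric m M) (h : RMetric n N) (φ : M → N) : Prop :=
  ∀ e ∈ atlas (𝔼 m) M, ∀ e' ∈ atlas (𝔼 n) N, ∀ p ∈ e.source, φ p ∈ e'.source →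
    ∀ u v : 𝔼 m, secondFund (metricIn g e) (metricIn h e') (mapIn φ e e') (e p) u v =
      metricIn g e (e p) u v •
        (m : ℝ)⁻¹ • tension (metricIn g e) (metricIn h e') (mapIn φ e e') (e p)

/-- The mean curvature vector field `η = (1/m) Trace ∇dφ` of the isometric immersion
`φ : (M, g) → (N, h)` is equal to `H ξ`. -/
def IsMeanCurvature (g : RMetric m M) (h : RMetric n N) (φ : M → N)
    (ξ : ∀ p : M, TangentSpace (𝓡 n) (φ p)) (H : M → ℝ) : Prop :=
  ∀ e ∈ atlas (𝔼 m) M, ∀ e' ∈ atlas (𝔼 n) N, ∀ p ∈ e.source, φ p ∈ e'.source →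
    (m : ℝ)⁻¹ • tension (metricIn g e) (metricIn h e') (mapIn φ e e') (e p) =
      H p • dChart e' (φ p) (ξ p)

/-- The map `φ : (M, g) → (N, h)` is biharmonic: its bitension field vanishes. -/
def IsBiharmonic (g : RMetric m M) (h : RMetric n N) (φ : M → N) : Prop :=
  ∀ p : M, bitension (metricIn g (chartAt (𝔼 m) p)) (metricIn h (chartAt (𝔼 n) (φ p)))
    (mapIn φ (chartAt (𝔼 m) p) (chartAt (𝔼 n) (φ p))) (chartAt (𝔼 m) p p) = 0

/-- The component `Z^⊤` of `Z` tangent to the isometric immersion `φ`, as a tangent vector of `M`: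
`g(Z^⊤, Y) = h(Z, dφ Y)`. -/
def tangential (g : RMetric m M) (h : RMetric n N) (φ : M → N) (p : M)
    (Z : TangentSpace (𝓡 n) (φ p)) : TangentSpace (𝓡 m) p :=
  (g.inner p).inverse ((h.inner (φ p) Z).comp (mfderiv (𝓡 m) (𝓡 n) φ p))

/-- The covariant derivative `∇^φ_X V` of a vector field `V` along `φ`. -/
def covDerivAlong (h : RMetric n N) (φ : M → N) (V : ∀ p : M, TangentSpace (𝓡 n) (φ p)) (p : M)
    (X : TangentSpace (𝓡 m) p) : TangentSpace (𝓡 n) (φ p) :=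
  (dChart (chartAt (𝔼 n) (φ p)) (φ p)).inverse
    (covDeriv (metricIn h (chartAt (𝔼 n) (φ p)))
      (mapIn φ (chartAt (𝔼 m) p) (chartAt (𝔼 n) (φ p)))
      (fieldIn V (chartAt (𝔼 m) p) (chartAt (𝔼 n) (φ p)))
      (chartAt (𝔼 m) p p) (dChart (chartAt (𝔼 m) p) p X))

/-- The shape operator `A X = -(∇^φ_X ξ)^⊤`. -/
def shapeOperator (g : RMetric m M) (h : RMetric n N) (φ : M → N)
    (ξ : ∀ p : M, TangentSpace (𝓡 n) (φ p)) (p : M) (X : TangentSpace (𝓡 m) p) :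
    TangentSpace (𝓡 m) p :=
  -tangential g h φ p (covDerivAlong h φ ξ p X)

/-- `|A|²`, the squared norm of the shape operator: the sum of `g(A e_i, A e_i)` over an
orthonormal frame. -/
def shapeNormSq (g : RMetric m M) (h : RMetric n N) (φ : M → N)
    (ξ : ∀ p : M, TangentSpace (𝓡 n) (φ p)) (p : M) : ℝ :=
  metricTrace (metricAt g p)
    (fun X Y => metricAt g p (shapeOperator g h φ ξ p X) (shapeOperator g h φ ξ p Y))

end Manifolds

end BiharmonicSurface

end

namespace BiharmonicSurface

/-! Put a = f⁻¹, so that the conformal metric is a g, and μ = 2fH. In dimension two the difference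
of the two Levi-Civita connections has zero trace (`metricTrace_christoffel_smul`), so passing from
g to a g only multiplies traces of Hessian type by f. Hence the tension field is μξ, and the
bitension field is f times the expression formed with g from the field μξ (`bitension_conformal`).

Umbilicity gives the Weingarten equation ∇_X ξ = -H dφ(X). Differentiating μξ twice and taking the
trace gives the normal part Δμ - 2μH² and the tangential part -(H grad μ + grad(μH)); the curvature
term contributes μ Ric(ξ, ·). The Codazzi equation, together with the Bianchi identity, gives Ric(ξ,
dφ X) = dH(X), which is assertion 3, and then the terms μ grad H cancel. Biharmonicity therefore
amounts to the pair Δμ + μ(Ric(ξ,ξ) - 2H²) = 0 and H grad μ = 0 (`bitension_conformal_eq_zero_iff`).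

The second equation says that (fH)² has zero derivative, so it is constant because M is connected.
This gives the dichotomy without any unique continuation. If the constant is 0, then H = 0
everywhere. Otherwise H vanishes nowhere, fH itself is constant, the Laplacian drops out, and the
first equation becomes Ric(ξ,ξ) = 2H² = |A|². Conversely, when fH is constant the pair reduces to
that same scalar equation.

The computation is local and takes place in one pair of charts at a time. Since the hypotheses on
the second fundamental form hold in every pair of atlas charts, coordinate invariance of the tension
field is never needed. -/

/-- A symmetric positive definite bilinear form. -/
structure IsInner {n : ℕ} (b : 𝔼 n →L[ℝ] 𝔼 n →L[ℝ] ℝ) : Prop where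
  symm : ∀ u v, b u v = b v u
  pos : ∀ u, u ≠ 0 → 0 < b u u

/-- The vectors `e i` are orthonormal for `b`. -/
def IsFrame {n : ℕ} {ι : Type*} [DecidableEq ι] (b : 𝔼 n →L[ℝ] 𝔼 n →L[ℝ] ℝ) (e : ι → 𝔼 n) : Prop :=
  ∀ i j, b (e i) (e j) = if i = j then 1 else 0

/-! ### Orthonormal frames and metric traces. -/

section LinearAlgebra

variable {n : ℕ} {b : 𝔼 n →L[ℝ] 𝔼 n →L[ℝ] ℝ} {W W' : Type*} [AddCommGroup W] [Module ℝ W]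
  [AddCommGroup W'] [Module ℝ W']

theorem IsInner.eq_zero (hb : IsInner b) {u : 𝔼 n} (h : b u u = 0) : u = 0 := by
  by_contra hu
  exact (hb.pos u hu).ne' h

theorem finrank_covector (n : ℕ) :
    Module.finrank ℝ (𝔼 n →L[ℝ] ℝ) = Module.finrank ℝ (𝔼 n) := by
  rw [← (LinearMap.toContinuousLinearMap : (𝔼 n →ₗ[ℝ] ℝ) ≃ₗ[ℝ] _).finrank_eq]
  exact Subspace.dual_finrank_eq

theorem IsInner.isInvertible (hb : IsInner b) : b.IsInvertible := by
  have hinj : Function.Injective (b : 𝔼 n →ₗ[ℝ] (𝔼 n →L[ℝ] ℝ)) := by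
    rw [injective_iff_map_eq_zero]
    intro u hu
    apply hb.eq_zero
    have : b u = 0 := hu
    rw [this]; rfl
  refine ⟨(LinearEquiv.ofInjectiveOfFinrankEq _ hinj
    (finrank_covector n).symm).toContinuousLinearEquiv, ?_⟩
  ext u v
  rfl

theorem IsInner.apply_inverse (hb : IsInner b) (α : 𝔼 n →L[ℝ] ℝ) : b (b.inverse α) = α :=
  hb.isInvertible.self_apply_inverse α

theorem IsInner.inverse_apply (hb : IsInner b) (u : 𝔼 n) : b.inverse (b u) = u :=
  hb.isInvertible.inverse_apply_self u

theorem IsInner.ext (hb : IsInner b) {u v : 𝔼 n} (h : ∀ w, b u w = b v w) : u = v :=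
  hb.isInvertible.injective (ContinuousLinearMap.ext h)

theorem IsFrame.linearIndependent {ι : Type*} [Fintype ι] [DecidableEq ι] {e : ι → 𝔼 n}
    (he : IsFrame b e) : LinearIndependent ℝ e := by
  rw [Fintype.linearIndependent_iff]
  intro g hg i
  have h1 : b (∑ j, g j • e j) (e i) = 0 := by rw [hg]; simp
  rw [map_sum, sum_apply] at h1
  have h2 : ∀ j, b (g j • e j) (e i) = if j = i then g j else 0 := by
    intro j
    rw [map_smul, smul_apply, he j i]
    split_ifs <;> simp
  rw [Finset.sum_congr rfl fun j _ => h2 j] at h1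
  simpa using h1

/-- A frame as a basis. -/
theorem IsFrame.exists_basis {ι : Type*} [Fintype ι] [DecidableEq ι] {e : ι → 𝔼 n}
    (he : IsFrame b e) (hc : Fintype.card ι = n) :
    ∃ B : Module.Basis ι ℝ (𝔼 n), (∀ i, B i = e i) ∧ ∀ v i, B.repr v i = b v (e i) := by
  classical
  rcases isEmpty_or_nonempty ι with hι | hι
  · have : n = 0 := by rw [← hc]; exact Fintype.card_eq_zero
    subst this
    exact ⟨Module.Basis.empty _, fun i => (hι.false i).elim, fun v i => (hι.false i).elim⟩
  have hc' : Fintype.card ι = Module.finrank ℝ (𝔼 n) := by simp [hc]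
  refine ⟨basisOfLinearIndependentOfCardEqFinrank he.linearIndependent hc', ?_, ?_⟩
  · intro i; simp
  · intro v i
    set B := basisOfLinearIndependentOfCardEqFinrank he.linearIndependent hc' with hB
    have hv := B.sum_repr v
    conv_rhs => rw [← hv]
    rw [map_sum, sum_apply]
    have h2 : ∀ j, b (B.repr v j • B j) (e i) = if j = i then B.repr v j else 0 := by
      intro j
      have : B j = e j := by simp [hB]
      rw [map_smul, smul_apply, this, he j i]
      split_ifs <;> simp
    rw [Finset.sum_congr rfl fun j _ => h2 j]
    simp

theorem IsFrame.sum_eq {ι : Type*} [Fintype ι] [DecidableEq ι] {e : ι → 𝔼 n}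
    (he : IsFrame b e) (hc : Fintype.card ι = n) (v : 𝔼 n) : ∑ i, b v (e i) • e i = v := by
  obtain ⟨B, hB, hr⟩ := he.exists_basis hc
  conv_rhs => rw [← B.sum_repr v]
  simp [hB, hr]

theorem IsFrame.inverse_eq {e : Fin n → 𝔼 n} (hb : IsInner b)
    (he : IsFrame b e) (α : 𝔼 n →L[ℝ] ℝ) : b.inverse α = ∑ i, α (e i) • e i := by
  rw [← he.sum_eq (by simp) (b.inverse α), hb.apply_inverse]

theorem IsInner.exists_frame (hb : IsInner b) : ∃ e : Fin n → 𝔼 n, IsFrame b e := by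
  let B : LinearMap.BilinForm ℝ (𝔼 n) :=
    (ContinuousLinearMap.coeLM ℝ).comp (b : 𝔼 n →ₗ[ℝ] (𝔼 n →L[ℝ] ℝ))
  have hB : ∀ u v, B u v = b u v := fun u v => rfl
  have hs : LinearMap.IsSymm B := ⟨fun u v => hb.symm u v⟩
  obtain ⟨v, hv⟩ := LinearMap.BilinForm.exists_orthogonal_basis hs
  have hn : Module.finrank ℝ (𝔼 n) = n := by simp
  let v' : Module.Basis (Fin n) ℝ (𝔼 n) := v.reindex (finCongr hn)
  have hv' : ∀ i j, i ≠ j → b (v' i) (v' j) = 0 := by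
    intro i j hij
    rw [← hB]
    simp only [v', Module.Basis.reindex_apply]
    exact hv (by simpa using hij)
  refine ⟨fun i => (Real.sqrt (b (v' i) (v' i)))⁻¹ • v' i, fun i j => ?_⟩
  simp only [map_smul, smul_apply, smul_eq_mul]
  split_ifs with h
  · subst h
    have hp := hb.pos _ (v'.ne_zero i)
    have hq := Real.mul_self_sqrt hp.le
    have hr := (Real.sqrt_pos.mpr hp).ne'
    field_simp
    nlinarith
  · rw [hv' i j h]; ring

theorem eq_sum_basisVec (v : 𝔼 n) : v = ∑ i, coordForm i v • basisVec i := by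
  have := (EuclideanSpace.basisFun (Fin n) ℝ).sum_repr v
  conv_lhs => rw [← this]
  simp [basisVec, coordForm]

/-- In an orthonormal frame the inverse Gram matrix is b^{ij} = ∑ₖ eₖⁱ eₖʲ; substituting this and
expanding by bilinearity turns the coordinate trace into a frame trace. -/
theorem metricTrace_eq_sum {e : Fin n → 𝔼 n} (hb : IsInner b) (he : IsFrame b e)
    (c : 𝔼 n →ₗ[ℝ] 𝔼 n →ₗ[ℝ] W) :
    metricTrace b (fun u v => c u v) = ∑ k, c (e k) (e k) := by
  have h1 : ∀ i j, coordForm i (b.inverse (coordForm j))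
      = ∑ k, coordForm i (e k) * coordForm j (e k) := by
    intro i j
    rw [he.inverse_eq hb, map_sum]
    refine Finset.sum_congr rfl fun k _ => ?_
    rw [map_smul, smul_eq_mul, mul_comm]
  have h2 : ∀ k, c (e k) (e k)
      = ∑ i, ∑ j, (coordForm i (e k) * coordForm j (e k)) • c (basisVec i) (basisVec j) := by
    intro k
    conv_lhs => rw [eq_sum_basisVec (e k)]
    simp only [map_sum, map_smul, LinearMap.sum_apply, LinearMap.smul_apply, Finset.smul_sum,
      smul_smul]
    rw [Finset.sum_comm]
    refine Finset.sum_congr rfl fun i _ => Finset.sum_congr rfl fun j _ => ?_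
    rw [mul_comm]
  simp only [metricTrace, h1, h2, Finset.sum_smul]
  rw [Finset.sum_comm' (t' := Finset.univ) (s' := fun _ => Finset.univ) (by simp)]
  rw [Finset.sum_comm]
  conv_rhs => rw [Finset.sum_comm]
  refine Finset.sum_congr rfl fun i _ => ?_
  conv_rhs => rw [Finset.sum_comm]

theorem metricTrace_add (c c' : 𝔼 n → 𝔼 n → W) :
    metricTrace b (fun u v => c u v + c' u v) = metricTrace b c + metricTrace b c' := by
  simp [metricTrace, Finset.sum_add_distrib]

theorem metricTrace_sub (c c' : 𝔼 n → 𝔼 n → W) :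
    metricTrace b (fun u v => c u v - c' u v) = metricTrace b c - metricTrace b c' := by
  simp [metricTrace, Finset.sum_sub_distrib, smul_sub]

theorem metricTrace_map (L : W →ₗ[ℝ] W') (c : 𝔼 n → 𝔼 n → W) :
    metricTrace b (fun u v => L (c u v)) = L (metricTrace b c) := by
  simp [metricTrace]

theorem metricTrace_smul (r : ℝ) (c : 𝔼 n → 𝔼 n → W) :
    metricTrace b (fun u v => r • c u v) = r • metricTrace b c :=
  metricTrace_map (LinearMap.lsmul ℝ W r) c

theorem metricTrace_smul_const (c : 𝔼 n → 𝔼 n → ℝ) (w : W) :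
    metricTrace b (fun u v => c u v • w) = metricTrace b c • w :=
  metricTrace_map (LinearMap.toSpanSingleton ℝ W w) c

/-- This and its transpose below are how gradients arise from traces, both in the conformal change
of connection and in the tangential part of the bitension field. -/
theorem metricTrace_covector_smul (hb : IsInner b) (α : 𝔼 n →L[ℝ] ℝ) :
    metricTrace b (fun u v => α u • v) = b.inverse α := by
  obtain ⟨e, he⟩ := hb.exists_frame
  rw [he.inverse_eq hb]
  exact metricTrace_eq_sum hb he
    (LinearMap.mk₂ ℝ (fun u v => α u • v) (by simp [add_smul]) (by simp [mul_smul]) (by simp)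
      (by intro c u v; simp [smul_smul, mul_comm]))

theorem metricTrace_covector_smul' (hb : IsInner b) (α : 𝔼 n →L[ℝ] ℝ) :
    metricTrace b (fun u v => α v • u) = b.inverse α := by
  obtain ⟨e, he⟩ := hb.exists_frame
  rw [he.inverse_eq hb]
  exact metricTrace_eq_sum hb he
    (LinearMap.mk₂ ℝ (fun u v => α v • u) (by simp) (by intro c u v; simp [smul_smul, mul_comm])
      (by simp [add_smul]) (by simp [mul_smul]))

theorem metricTrace_self (hb : IsInner b) : metricTrace b (fun u v => b u v) = n := by
  obtain ⟨e, he⟩ := hb.exists_frame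
  refine (metricTrace_eq_sum hb he
    (LinearMap.mk₂ ℝ (fun u v => b u v) (by simp) (by simp) (by simp) (by simp))).trans ?_
  simp [he _ _]

theorem metricTrace_smul_metric {a : ℝ} (hb : IsInner b) (ha : a ≠ 0) (c : 𝔼 n → 𝔼 n → W) :
    metricTrace (a • b) c = a⁻¹ • metricTrace b c := by
  have h : ∀ α, (a • b).inverse α = a⁻¹ • b.inverse α := by
    intro α
    have hb' : (a • b).IsInvertible := by
      obtain ⟨e, he⟩ := hb.isInvertible
      refine ⟨e.trans (ContinuousLinearEquiv.smulLeft (Units.mk0 a ha)), ?_⟩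
      ext u v
      simp [← he]
    apply hb'.injective
    rw [hb'.self_apply_inverse]
    simp [hb.apply_inverse, smul_smul, ha]
  simp [metricTrace, h, Finset.smul_sum, smul_smul]

/-- Basis independence of the trace of an endomorphism. It allows `ricciForm`, defined with the
standard basis, to be evaluated in a frame adapted to the surface. -/
theorem sum_coordForm_eq_sum {ι : Type*} [Fintype ι] [DecidableEq ι] {e : ι → 𝔼 n}
    (he : IsFrame b e) (hc : Fintype.card ι = n) (T : 𝔼 n →ₗ[ℝ] 𝔼 n) :
    ∑ i, coordForm i (T (basisVec i)) = ∑ k, b (T (e k)) (e k) := by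
  obtain ⟨B, hB, hr⟩ := he.exists_basis hc
  have h1 := LinearMap.trace_eq_matrix_trace ℝ B T
  have h2 := LinearMap.trace_eq_matrix_trace ℝ (EuclideanSpace.basisFun (Fin n) ℝ).toBasis T
  rw [h1] at h2
  simpa [Matrix.trace, LinearMap.toMatrix_apply, hr, hB, basisVec, coordForm] using h2.symm

end LinearAlgebra

/-! ### The Levi-Civita connection in coordinates. -/

/-- `K` is a smooth Riemannian metric on the open set `V`. -/
structure IsMetricOn {n : ℕ} (K : 𝔼 n → (𝔼 n →L[ℝ] 𝔼 n →L[ℝ] ℝ)) (V : Set (𝔼 n)) : Prop where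
  isOpen : IsOpen V
  contDiffOn : ContDiffOn ℝ ∞ K V
  inner : ∀ x ∈ V, IsInner (K x)

section Calculus

open Filter Topology

variable {m n : ℕ} {K : 𝔼 n → (𝔼 n →L[ℝ] 𝔼 n →L[ℝ] ℝ)} {V : Set (𝔼 n)}

theorem _root_.ContDiffOn.differentiableAt_of_isOpen {E F : Type*} [NormedAddCommGroup E]
    [NormedSpace ℝ E] [NormedAddCommGroup F] [NormedSpace ℝ F] {f : E → F} {s : Set E}
    (hf : ContDiffOn ℝ ∞ f s) (hs : IsOpen s) {x : E} (hx : x ∈ s) : DifferentiableAt ℝ f x :=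
  (hf.contDiffAt (hs.mem_nhds hx)).differentiableAt (by simp)

theorem _root_.ContDiffOn.fderiv_smooth {E F : Type*} [NormedAddCommGroup E]
    [NormedSpace ℝ E] [NormedAddCommGroup F] [NormedSpace ℝ F] {f : E → F} {s : Set E}
    (hf : ContDiffOn ℝ ∞ f s) (hs : IsOpen s) : ContDiffOn ℝ ∞ (fderiv ℝ f) s :=
  hf.fderiv_of_isOpen hs (by simp)

theorem fderiv_fderiv_comm {E F : Type*} [NormedAddCommGroup E]
    [NormedSpace ℝ E] [NormedAddCommGroup F] [NormedSpace ℝ F] {f : E → F} {s : Set E}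
    (hf : ContDiffOn ℝ ∞ f s) (hs : IsOpen s) {x : E} (hx : x ∈ s) (u v : E) :
    fderiv ℝ (fderiv ℝ f) x u v = fderiv ℝ (fderiv ℝ f) x v u :=
  ((hf.contDiffAt (hs.mem_nhds hx)).isSymmSndFDerivAt (by
    rw [minSmoothness_of_isRCLikeNormedField]; exact WithTop.coe_le_coe.mpr (le_top : (2 : ℕ∞) ≤ ⊤))).eq u v

theorem fderiv_apply_const {E F : Type*} [NormedAddCommGroup E]
    [NormedSpace ℝ E] [NormedAddCommGroup F] [NormedSpace ℝ F] {f : E → F} {s : Set E}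
    (hf : ContDiffOn ℝ ∞ f s) (hs : IsOpen s) {x : E} (hx : x ∈ s) (u v : E) :
    fderiv ℝ (fun y => fderiv ℝ f y v) x u = fderiv ℝ (fderiv ℝ f) x u v := by
  rw [fderiv_clm_apply
    ((ContDiffOn.fderiv_smooth hf hs).differentiableAt_of_isOpen hs hx) (by fun_prop)]
  simp

theorem IsMetricOn.fderiv_symm (hK : IsMetricOn K V) {x : 𝔼 n} (hx : x ∈ V) (u v w : 𝔼 n) :
    fderiv ℝ K x u v w = fderiv ℝ K x u w v := by
  have hd := hK.contDiffOn.differentiableAt_of_isOpen hK.isOpen hx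
  have h : ∀ v w, fderiv ℝ (fun y => K y v w) x u = fderiv ℝ K x u v w := by
    intro v w
    rw [fderiv_clm_apply (by fun_prop) (by fun_prop), fderiv_clm_apply hd (by fun_prop)]
    simp
  rw [← h, ← h]
  refine congrArg (fun L : 𝔼 n →L[ℝ] ℝ => L u) (Filter.EventuallyEq.fderiv_eq ?_)
  filter_upwards [hK.isOpen.mem_nhds hx] with y hy using (hK.inner y hy).symm v w

theorem IsMetricOn.apply_christoffel (hK : IsMetricOn K V) {x : 𝔼 n} (hx : x ∈ V) (u v w : 𝔼 n) :
    K x (christoffel K x u v) w =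
      (1 / 2 : ℝ) * (fderiv ℝ K x u v w + fderiv ℝ K x v u w - fderiv ℝ K x w u v) := by
  rw [christoffel_apply, (hK.inner x hx).apply_inverse, christoffelFirst_apply]

theorem IsMetricOn.christoffel_symm (hK : IsMetricOn K V) {x : 𝔼 n} (hx : x ∈ V) (u v : 𝔼 n) :
    christoffel K x u v = christoffel K x v u := by
  apply (hK.inner x hx).ext
  intro w
  rw [hK.apply_christoffel hx, hK.apply_christoffel hx, hK.fderiv_symm hx w u v]
  ring

/-- Metric compatibility of the connection: adding the two Koszul expressions leaves only the
derivative in the direction `u`. -/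
theorem IsMetricOn.fderiv_eq (hK : IsMetricOn K V) {x : 𝔼 n} (hx : x ∈ V) (u v w : 𝔼 n) :
    fderiv ℝ K x u v w = K x (christoffel K x u v) w + K x v (christoffel K x u w) := by
  rw [(hK.inner x hx).symm v, hK.apply_christoffel hx, hK.apply_christoffel hx,
    hK.fderiv_symm hx u w v]
  ring

theorem IsMetricOn.contDiffOn_christoffel (hK : IsMetricOn K V) :
    ContDiffOn ℝ ∞ (christoffel K) V := by
  have hD := hK.contDiffOn.fderiv_smooth hK.isOpen
  have h1 : ContDiffOn ℝ ∞ (christoffelFirst K) V := by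
    simp only [contDiffOn_clm_apply] at hD ⊢
    intro u v w
    simp only [christoffelFirst_apply]
    exact contDiffOn_const.mul (((hD u v w).add (hD v u w)).sub (hD w u v))
  have h2 : ContDiffOn ℝ ∞ (fun x => (K x).inverse) V := by
    intro x hx
    exact ((hK.inner x hx).isInvertible.contDiffAt_map_inverse.comp x
      (hK.contDiffOn.contDiffAt (hK.isOpen.mem_nhds hx))).contDiffWithinAt
  have h3 : ContDiffOn ℝ ∞ (fun x => ContinuousLinearMap.compL ℝ (𝔼 n) (𝔼 n →L[ℝ] ℝ) (𝔼 n)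
      (K x).inverse) V :=
    (ContinuousLinearMap.compL ℝ (𝔼 n) (𝔼 n →L[ℝ] ℝ) (𝔼 n)).contDiff.comp_contDiffOn h2
  exact h3.clm_comp h1

theorem IsMetricOn.differentiableAt_christoffel (hK : IsMetricOn K V) {x : 𝔼 n} (hx : x ∈ V) :
    DifferentiableAt ℝ (christoffel K) x :=
  hK.contDiffOn_christoffel.differentiableAt_of_isOpen hK.isOpen hx

/-! ### Covariant differentiation of vector fields along a map. -/

section covDeriv

variable {φ : 𝔼 m → 𝔼 n} {X Y : 𝔼 m → 𝔼 n} {x : 𝔼 m} {U : Set (𝔼 m)}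

theorem covDeriv_congr (h : X =ᶠ[𝓝 x] Y) (u : 𝔼 m) :
    covDeriv K φ X x u = covDeriv K φ Y x u := by
  rw [covDeriv, covDeriv, h.fderiv_eq, h.self_of_nhds]

theorem covDeriv_add (hX : DifferentiableAt ℝ X x) (hY : DifferentiableAt ℝ Y x) (u : 𝔼 m) :
    covDeriv K φ (fun y => X y + Y y) x u = covDeriv K φ X x u + covDeriv K φ Y x u := by
  simp only [covDeriv]
  rw [fderiv_fun_add hX hY]
  simp only [add_apply, map_add]
  abel

theorem covDeriv_smul {a : 𝔼 m → ℝ} (ha : DifferentiableAt ℝ a x) (hX : DifferentiableAt ℝ X x)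
    (u : 𝔼 m) : covDeriv K φ (fun y => a y • X y) x u =
      fderiv ℝ a x u • X x + a x • covDeriv K φ X x u := by
  simp only [covDeriv]
  rw [fderiv_fun_smul ha hX]
  simp only [add_apply, smul_apply, map_smul, smul_add,
    ContinuousLinearMap.smulRight_apply]
  abel

theorem covDeriv_apply_add (u v : 𝔼 m) :
    covDeriv K φ X x (u + v) = covDeriv K φ X x u + covDeriv K φ X x v := by
  simp only [covDeriv, map_add, add_apply]
  abel

theorem covDeriv_apply_smul (r : ℝ) (u : 𝔼 m) :
    covDeriv K φ X x (r • u) = r • covDeriv K φ X x u := by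
  simp only [covDeriv, map_smul, smul_apply, smul_add]

theorem IsMetricOn.fderiv_inner (hK : IsMetricOn K V) (hx : φ x ∈ V)
    (hφ : DifferentiableAt ℝ φ x) (hX : DifferentiableAt ℝ X x) (hY : DifferentiableAt ℝ Y x)
    (u : 𝔼 m) : fderiv ℝ (fun y => K (φ y) (X y) (Y y)) x u =
      K (φ x) (covDeriv K φ X x u) (Y x) + K (φ x) (X x) (covDeriv K φ Y x u) := by
  have hd := (hK.contDiffOn.differentiableAt_of_isOpen hK.isOpen hx).hasFDerivAt.comp x
    hφ.hasFDerivAt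
  have h := ((hd.clm_apply hX.hasFDerivAt).clm_apply hY.hasFDerivAt).fderiv
  simp only [Function.comp_def] at h
  rw [h]
  simp only [covDeriv, add_apply, map_add, ContinuousLinearMap.comp_apply,
    ContinuousLinearMap.flip_apply, hK.fderiv_eq hx]
  ring

theorem IsMetricOn.contDiffOn_covDeriv (hK : IsMetricOn K V) (hU : IsOpen U)
    (hφV : Set.MapsTo φ U V) (hφ : ContDiffOn ℝ ∞ φ U) (hX : ContDiffOn ℝ ∞ X U) (u : 𝔼 m) :
    ContDiffOn ℝ ∞ (fun y => covDeriv K φ X y u) U := by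
  have hΓ : ContDiffOn ℝ ∞ (fun y => christoffel K (φ y)) U :=
    hK.contDiffOn_christoffel.comp hφ hφV
  exact ((hX.fderiv_smooth hU).clm_apply contDiffOn_const).add
    ((hΓ.clm_apply ((hφ.fderiv_smooth hU).clm_apply contDiffOn_const)).clm_apply hX)

theorem IsMetricOn.fderiv_covDeriv (hK : IsMetricOn K V) (hU : IsOpen U) (hx : x ∈ U)
    (hφV : Set.MapsTo φ U V) (hφ : ContDiffOn ℝ ∞ φ U) (hX : ContDiffOn ℝ ∞ X U) (u v : 𝔼 m) :
    fderiv ℝ (fun y => covDeriv K φ X y v) x u = fderiv ℝ (fderiv ℝ X) x u v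
      + (fderiv ℝ (christoffel K) (φ x) (fderiv ℝ φ x u) (fderiv ℝ φ x v) (X x)
        + christoffel K (φ x) (fderiv ℝ (fderiv ℝ φ) x u v) (X x)
        + christoffel K (φ x) (fderiv ℝ φ x v) (fderiv ℝ X x u)) := by
  have hΓ := (hK.differentiableAt_christoffel (hφV hx)).hasFDerivAt.comp x
    (hφ.differentiableAt_of_isOpen hU hx).hasFDerivAt
  have h1 := ((hφ.fderiv_smooth hU).differentiableAt_of_isOpen hU hx).hasFDerivAt.clm_apply
    (hasFDerivAt_const v x)
  have h2 := ((hX.fderiv_smooth hU).differentiableAt_of_isOpen hU hx).hasFDerivAt.clm_apply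
    (hasFDerivAt_const v x)
  have h := (h2.add ((hΓ.clm_apply h1).clm_apply
    (hX.differentiableAt_of_isOpen hU hx).hasFDerivAt)).fderiv
  simp only [Function.comp_def] at h
  change fderiv ℝ (fun y => covDeriv K φ X y v) x = _ at h
  rw [h]
  simp
  abel

/-- The Ricci identity for vector fields along a map. -/
theorem IsMetricOn.covDeriv_comm (hK : IsMetricOn K V) (hU : IsOpen U) (hx : x ∈ U)
    (hφV : Set.MapsTo φ U V) (hφ : ContDiffOn ℝ ∞ φ U) (hX : ContDiffOn ℝ ∞ X U) (u v : 𝔼 m) :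
    covDeriv K φ (fun y => covDeriv K φ X y v) x u - covDeriv K φ (fun y => covDeriv K φ X y u) x v
      = curvature K (φ x) (fderiv ℝ φ x u) (fderiv ℝ φ x v) (X x) := by
  rw [covDeriv, hK.fderiv_covDeriv hU hx hφV hφ hX,
    covDeriv.eq_1 K φ (fun y => covDeriv K φ X y u), hK.fderiv_covDeriv hU hx hφV hφ hX,
    fderiv_fderiv_comm hX hU hx v u, fderiv_fderiv_comm hφ hU hx v u]
  simp only [covDeriv, curvature, add_apply, sub_apply, ContinuousLinearMap.comp_apply, map_add]
  abel

/-- Torsion-freeness pulled back by the map: second derivatives commute and the Christoffel symbols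
are symmetric. -/
theorem IsMetricOn.covDeriv_fderiv_symm (hK : IsMetricOn K V) (hU : IsOpen U) (hx : x ∈ U)
    (hφV : Set.MapsTo φ U V) (hφ : ContDiffOn ℝ ∞ φ U) (u v : 𝔼 m) :
    covDeriv K φ (fun y => fderiv ℝ φ y v) x u = covDeriv K φ (fun y => fderiv ℝ φ y u) x v := by
  rw [covDeriv, covDeriv, fderiv_apply_const hφ hU hx, fderiv_apply_const hφ hU hx,
    fderiv_fderiv_comm hφ hU hx u v, hK.christoffel_symm (hφV hx)]

end covDeriv

/-! ### Symmetries of the curvature tensor. -/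

theorem curvature_add_left (x u u' v w : 𝔼 n) :
    curvature K x (u + u') v w = curvature K x u v w + curvature K x u' v w := by
  simp [curvature]
  abel

theorem curvature_smul_left (r : ℝ) (x u v w : 𝔼 n) :
    curvature K x (r • u) v w = r • curvature K x u v w := by
  simp [curvature, smul_sub, smul_add]

theorem curvature_smul_right (r : ℝ) (x u v w : 𝔼 n) :
    curvature K x u (r • v) w = r • curvature K x u v w := by
  simp [curvature, smul_sub, smul_add]

/-- The Christoffel symbols, and hence their derivatives, are symmetric in the lower slots, so all
terms cancel in pairs in the cyclic sum. -/
theorem IsMetricOn.curvature_bianchi (hK : IsMetricOn K V) {x : 𝔼 n} (hx : x ∈ V) (u v w : 𝔼 n) :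
    curvature K x u v w + curvature K x v w u + curvature K x w u v = 0 := by
  have hd := hK.differentiableAt_christoffel hx
  have h : ∀ u v w, fderiv ℝ (christoffel K) x u v w = fderiv ℝ (christoffel K) x u w v := by
    intro u v w
    have h1 : ∀ v w, fderiv ℝ (fun y => christoffel K y v w) x u
        = fderiv ℝ (christoffel K) x u v w := by
      intro v w
      rw [fderiv_clm_apply (by fun_prop) (by fun_prop), fderiv_clm_apply hd (by fun_prop)]
      simp
    rw [← h1, ← h1]
    refine congrArg (fun L : 𝔼 n →L[ℝ] 𝔼 n => L u) (Filter.EventuallyEq.fderiv_eq ?_)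
    filter_upwards [hK.isOpen.mem_nhds hx] with y hy using hK.christoffel_symm hy v w
  simp only [curvature, add_apply, sub_apply, ContinuousLinearMap.comp_apply]
  rw [h u v w, h v w u, h w u v, hK.christoffel_symm hx v w, hK.christoffel_symm hx w u,
    hK.christoffel_symm hx u v]
  abel

/-- For constant fields w, z the second derivative of K(w, z) is symmetric. Expanding it by metric
compatibility and antisymmetrising, the products of first covariant derivatives cancel and only
curvature terms remain. -/
theorem IsMetricOn.curvature_skew (hK : IsMetricOn K V) {x : 𝔼 n} (hx : x ∈ V) (u v w z : 𝔼 n) :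
    K x (curvature K x u v w) z = -K x w (curvature K x u v z) := by
  -- Vector fields on `V` are regarded as fields along the identity map, so that the product rule
  -- and the Ricci identity along maps apply.
  have hid : ContDiffOn ℝ ∞ (id : 𝔼 n → 𝔼 n) V := contDiffOn_id
  have hmap : Set.MapsTo (id : 𝔼 n → 𝔼 n) V V := Set.mapsTo_id V
  have hc : ∀ c : 𝔼 n, ContDiffOn ℝ ∞ (fun _ : 𝔼 n => c) V := fun c => contDiffOn_const
  have hcov : ∀ c v : 𝔼 n, ContDiffOn ℝ ∞ (fun y => covDeriv K id (fun _ : 𝔼 n => c) y v) V :=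
    fun c v => hK.contDiffOn_covDeriv hK.isOpen hmap hid (hc c) v
  have hs : ContDiffOn ℝ ∞ (fun y => K y w z) V :=
    (hK.contDiffOn.clm_apply contDiffOn_const).clm_apply contDiffOn_const
  have h2 : ∀ u v : 𝔼 n, fderiv ℝ (fderiv ℝ (fun y => K y w z)) x u v =
      K x (covDeriv K id (fun y => covDeriv K id (fun _ : 𝔼 n => w) y v) x u) z
      + K x (covDeriv K id (fun _ : 𝔼 n => w) x v) (covDeriv K id (fun _ : 𝔼 n => z) x u)
      + (K x (covDeriv K id (fun _ : 𝔼 n => w) x u) (covDeriv K id (fun _ : 𝔼 n => z) x v)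
      + K x w (covDeriv K id (fun y => covDeriv K id (fun _ : 𝔼 n => z) y v) x u)) := by
    intro u v
    rw [← fderiv_apply_const hs hK.isOpen hx]
    have he : (fun y => fderiv ℝ (fun y => K y w z) y v) =ᶠ[𝓝 x]
        fun y => K (id y) (covDeriv K id (fun _ : 𝔼 n => w) y v) ((fun _ => z) y)
          + K (id y) ((fun _ => w) y) (covDeriv K id (fun _ : 𝔼 n => z) y v) := by
      filter_upwards [hK.isOpen.mem_nhds hx] with y hy
      exact hK.fderiv_inner (φ := id) hy differentiableAt_id (differentiableAt_const w)
        (differentiableAt_const z) v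
    have hKd := hK.contDiffOn.differentiableAt_of_isOpen hK.isOpen hx
    have hw := (hcov w v).differentiableAt_of_isOpen hK.isOpen hx
    have hz := (hcov z v).differentiableAt_of_isOpen hK.isOpen hx
    have e1 := hK.fderiv_inner (φ := id) hx differentiableAt_id hw (differentiableAt_const z) u
    have e2 := hK.fderiv_inner (φ := id) hx differentiableAt_id (differentiableAt_const w) hz u
    refine (congrArg (fun L : 𝔼 n →L[ℝ] ℝ => L u) he.fderiv_eq).trans
      ((congrArg (fun L : 𝔼 n →L[ℝ] ℝ => L u)
        (fderiv_fun_add ((hKd.clm_apply hw).clm_apply (differentiableAt_const z))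
          ((hKd.clm_apply (differentiableAt_const w)).clm_apply hz))).trans ?_)
    exact congrArg₂ (· + ·) e1 e2
  have h3 := fderiv_fderiv_comm hs hK.isOpen hx u v
  have hw := hK.covDeriv_comm hK.isOpen hx hmap hid (hc w) u v
  have hz := hK.covDeriv_comm hK.isOpen hx hmap hid (hc z) u v
  simp only [fderiv_id, ContinuousLinearMap.id_apply, id] at hw hz
  rw [← hw, ← hz, map_sub, map_sub, sub_apply]
  rw [h2, h2] at h3
  simp only at h3 ⊢
  linarith

theorem IsMetricOn.smul (hK : IsMetricOn K V) {a : 𝔼 n → ℝ} (ha : ContDiffOn ℝ ∞ a V)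
    (hpos : ∀ x ∈ V, 0 < a x) : IsMetricOn (fun x => a x • K x) V where
  isOpen := hK.isOpen
  contDiffOn := ha.smul hK.contDiffOn
  inner x hx := ⟨fun u v => by simp [(hK.inner x hx).symm u v],
    fun u hu => mul_pos (hpos x hx) ((hK.inner x hx).pos u hu)⟩

/-- The classical conformal change of connection, checked by pairing with `w` in the metric aK and
comparing Koszul formulas. -/
theorem IsMetricOn.christoffel_smul (hK : IsMetricOn K V) {a : 𝔼 n → ℝ} (ha : ContDiffOn ℝ ∞ a V)
    (hpos : ∀ x ∈ V, 0 < a x) {x : 𝔼 n} (hx : x ∈ V) (u v : 𝔼 n) :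
    christoffel (fun x => a x • K x) x u v = christoffel K x u v + (2 * a x)⁻¹ •
      (fderiv ℝ a x u • v + fderiv ℝ a x v • u - K x u v • (K x).inverse (fderiv ℝ a x)) := by
  have hm := hK.smul ha hpos
  have hne := (hpos x hx).ne'
  apply (hm.inner x hx).ext
  intro w
  have hfd : ∀ u v w, fderiv ℝ (fun x => a x • K x) x u v w =
      a x * fderiv ℝ K x u v w + fderiv ℝ a x u * K x v w := by
    intro u v w
    rw [fderiv_fun_smul (ha.differentiableAt_of_isOpen hK.isOpen hx)
      (hK.contDiffOn.differentiableAt_of_isOpen hK.isOpen hx)]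
    simp
  rw [hm.apply_christoffel hx, hfd, hfd, hfd]
  simp only [smul_apply, map_add, map_sub, map_smul, add_apply, sub_apply, smul_eq_mul,
    (hK.inner x hx).apply_inverse, hK.apply_christoffel hx]
  rw [(hK.inner x hx).symm u v]
  field_simp
  ring

end Calculus

/-! ### Conformal change of metric on a surface. -/

section Conformal

variable {G : 𝔼 2 → (𝔼 2 →L[ℝ] 𝔼 2 →L[ℝ] ℝ)} {U : Set (𝔼 2)} {a : 𝔼 2 → ℝ}

/-- The trace of the correction term is a multiple of grad a + grad a - n grad a, which vanishes
exactly because n = 2. -/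
theorem IsMetricOn.metricTrace_christoffel_smul (hG : IsMetricOn G U) (ha : ContDiffOn ℝ ∞ a U)
    (hpos : ∀ x ∈ U, 0 < a x) {x : 𝔼 2} (hx : x ∈ U) :
    metricTrace (G x) (fun u v => christoffel (fun x => a x • G x) x u v) =
      metricTrace (G x) (fun u v => christoffel G x u v) := by
  simp only [hG.christoffel_smul ha hpos hx]
  rw [metricTrace_add, metricTrace_smul, metricTrace_sub, metricTrace_add,
    metricTrace_covector_smul (hG.inner x hx), metricTrace_covector_smul' (hG.inner x hx),
    metricTrace_smul_const, metricTrace_self (hG.inner x hx)]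
  simp [two_smul]

/-- In dimension two, traces of Hessian type are conformally invariant up to a factor. -/
theorem IsMetricOn.metricTrace_smul_sub (hG : IsMetricOn G U) (ha : ContDiffOn ℝ ∞ a U)
    (hpos : ∀ x ∈ U, 0 < a x) {x : 𝔼 2} (hx : x ∈ U) {W : Type*} [AddCommGroup W] [Module ℝ W]
    (c : 𝔼 2 → 𝔼 2 → W) (L : 𝔼 2 →ₗ[ℝ] W) :
    metricTrace (a x • G x) (fun u v => c u v - L (christoffel (fun x => a x • G x) x u v)) =
      (a x)⁻¹ • metricTrace (G x) (fun u v => c u v - L (christoffel G x u v)) := by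
  rw [metricTrace_smul_metric (hG.inner x hx) (hpos x hx).ne', metricTrace_sub, metricTrace_sub,
    metricTrace_map L, metricTrace_map L, hG.metricTrace_christoffel_smul ha hpos hx]

end Conformal

/-! ### Umbilical surfaces in coordinates: structure equations and bitension field. -/

/-- A totally umbilical surface in coordinates: `F` is an isometric immersion of `(U, G)` into
`(V, K)` with unit normal field `ν` and second fundamental form `G ⊗ H ν`. -/
structure IsUmbilicalSurface (G : 𝔼 2 → (𝔼 2 →L[ℝ] 𝔼 2 →L[ℝ] ℝ))
    (K : 𝔼 3 → (𝔼 3 →L[ℝ] 𝔼 3 →L[ℝ] ℝ)) (F ν : 𝔼 2 → 𝔼 3) (H : 𝔼 2 → ℝ)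
    (U : Set (𝔼 2)) (V : Set (𝔼 3)) : Prop where
  domain : IsMetricOn G U
  target : IsMetricOn K V
  mapsTo : Set.MapsTo F U V
  smooth : ContDiffOn ℝ ∞ F U
  smooth_normal : ContDiffOn ℝ ∞ ν U
  isometric : ∀ x ∈ U, ∀ u v, K (F x) (fderiv ℝ F x u) (fderiv ℝ F x v) = G x u v
  unit : ∀ x ∈ U, K (F x) (ν x) (ν x) = 1
  normal : ∀ x ∈ U, ∀ u, K (F x) (fderiv ℝ F x u) (ν x) = 0
  umbilical : ∀ x ∈ U, ∀ u v, secondFund G K F x u v = (G x u v * H x) • ν x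

/-- The Hessian of a function. -/
noncomputable def hessian {n : ℕ} (G : 𝔼 n → (𝔼 n →L[ℝ] 𝔼 n →L[ℝ] ℝ)) (a : 𝔼 n → ℝ)
    (x u v : 𝔼 n) : ℝ :=
  fderiv ℝ (fun y => fderiv ℝ a y v) x u - fderiv ℝ a x (christoffel G x u v)

section Surface

open Filter Topology

variable {G : 𝔼 2 → (𝔼 2 →L[ℝ] 𝔼 2 →L[ℝ] ℝ)}
    {K : 𝔼 3 → (𝔼 3 →L[ℝ] 𝔼 3 →L[ℝ] ℝ)} {F ν : 𝔼 2 → 𝔼 3} {H : 𝔼 2 → ℝ}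
    {U : Set (𝔼 2)} {V : Set (𝔼 3)} {x : 𝔼 2}

namespace IsUmbilicalSurface

theorem isOpen (S : IsUmbilicalSurface G K F ν H U V) : IsOpen U := S.domain.isOpen

theorem innerAt (S : IsUmbilicalSurface G K F ν H U V) (hx : x ∈ U) : IsInner (K (F x)) :=
  S.target.inner _ (S.mapsTo hx)

theorem normal' (S : IsUmbilicalSurface G K F ν H U V) (hx : x ∈ U) (u : 𝔼 2) :
    K (F x) (ν x) (fderiv ℝ F x u) = 0 := by
  rw [(S.innerAt hx).symm, S.normal x hx]

theorem isFrame (S : IsUmbilicalSurface G K F ν H U V) (hx : x ∈ U) {e : Fin 2 → 𝔼 2}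
    (he : IsFrame (G x) e) :
    IsFrame (K (F x)) (Fin.cons (ν x) (fun i => fderiv ℝ F x (e i)) : Fin 3 → 𝔼 3) := by
  intro i j
  refine Fin.cases ?_ (fun i => ?_) i <;> refine Fin.cases ?_ (fun j => ?_) j
  · simp [S.unit x hx]
  · simpa [Fin.succ_ne_zero, (Fin.succ_ne_zero _).symm] using S.normal' hx _
  · simpa [Fin.succ_ne_zero] using S.normal x hx _
  · simp [S.isometric x hx, he i j]

/-- The normal and the image of a frame of the surface form a frame of the target, so a vector is
determined by its normal and tangential pairings. -/
theorem ext (S : IsUmbilicalSurface G K F ν H U V) (hx : x ∈ U) {Z Z' : 𝔼 3}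
    (h1 : K (F x) Z (ν x) = K (F x) Z' (ν x))
    (h2 : ∀ w, K (F x) Z (fderiv ℝ F x w) = K (F x) Z' (fderiv ℝ F x w)) : Z = Z' := by
  obtain ⟨e, he⟩ := (S.domain.inner x hx).exists_frame
  have hf := S.isFrame hx he
  rw [← hf.sum_eq (by simp) Z, ← hf.sum_eq (by simp) Z']
  refine Finset.sum_congr rfl fun i _ => ?_
  congr 1
  refine Fin.cases ?_ (fun i => ?_) i
  · exact h1
  · exact h2 (e i)

theorem differentiableAt (S : IsUmbilicalSurface G K F ν H U V) (hx : x ∈ U) :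
    DifferentiableAt ℝ F x := S.smooth.differentiableAt_of_isOpen S.isOpen hx

theorem differentiableAt_normal (S : IsUmbilicalSurface G K F ν H U V) (hx : x ∈ U) :
    DifferentiableAt ℝ ν x := S.smooth_normal.differentiableAt_of_isOpen S.isOpen hx

theorem contDiffOn_fderiv (S : IsUmbilicalSurface G K F ν H U V) (u : 𝔼 2) :
    ContDiffOn ℝ ∞ (fun y => fderiv ℝ F y u) U :=
  (S.smooth.fderiv_smooth S.isOpen).clm_apply contDiffOn_const

theorem covDeriv_fderiv (S : IsUmbilicalSurface G K F ν H U V) (hx : x ∈ U) (u v : 𝔼 2) :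
    covDeriv K F (fun y => fderiv ℝ F y v) x u =
      (G x u v * H x) • ν x + fderiv ℝ F x (christoffel G x u v) := by
  rw [← S.umbilical x hx, secondFund]
  abel

/-- The Weingarten equation. -/
theorem weingarten (S : IsUmbilicalSurface G K F ν H U V) (hx : x ∈ U) (u : 𝔼 2) :
    covDeriv K F ν x u = -H x • fderiv ℝ F x u := by
  have hd := S.differentiableAt hx
  have hn := S.differentiableAt_normal hx
  apply S.ext hx
  -- Normal component: differentiate ⟨ν, ν⟩ = 1.
  · have h1 := S.target.fderiv_inner (S.mapsTo hx) hd hn hn u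
    have h2 : (fun y => K (F y) (ν y) (ν y)) =ᶠ[𝓝 x] fun _ => (1 : ℝ) := by
      filter_upwards [S.isOpen.mem_nhds hx] with y hy using S.unit y hy
    rw [h2.fderiv_eq, (S.innerAt hx).symm (ν x)] at h1
    simp only [fderiv_fun_const, Pi.zero_apply, zero_apply] at h1
    rw [map_smul, smul_apply, S.normal x hx, smul_zero]
    linarith
  -- Tangential components: differentiate ⟨ν, dF w⟩ = 0 and insert the second fundamental form.
  · intro w
    have h1 := S.target.fderiv_inner (S.mapsTo hx) hd hn
      ((S.contDiffOn_fderiv w).differentiableAt_of_isOpen S.isOpen hx) u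
    have h2 : (fun y => K (F y) (ν y) (fderiv ℝ F y w)) =ᶠ[𝓝 x] fun _ => (0 : ℝ) := by
      filter_upwards [S.isOpen.mem_nhds hx] with y hy using S.normal' hy w
    rw [h2.fderiv_eq, S.covDeriv_fderiv hx, map_add, map_smul, S.unit x hx, S.normal' hx] at h1
    simp only [fderiv_fun_const, Pi.zero_apply, zero_apply, smul_eq_mul] at h1
    rw [map_smul, smul_apply, S.isometric x hx, smul_eq_mul]
    linarith

/-- Smoothness of `H` is not assumed. It is recovered from the Weingarten equation, paired with
dF(b) for a fixed nonzero vector `b` and divided by G(b, b). -/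
theorem contDiffOn_meanCurvature (S : IsUmbilicalSurface G K F ν H U V) : ContDiffOn ℝ ∞ H U := by
  let b : 𝔼 2 := basisVec 0
  have hb : b ≠ 0 := by
    intro h
    have := congrArg (fun z : 𝔼 2 => z 0) h
    simp [b, basisVec] at this
  have hne : ∀ y ∈ U, G y b b ≠ 0 := fun y hy => ((S.domain.inner y hy).pos b hb).ne'
  have h1 : ContDiffOn ℝ ∞ (fun y => K (F y) (covDeriv K F ν y b) (fderiv ℝ F y b)) U :=
    ((S.target.contDiffOn.comp S.smooth S.mapsTo).clm_apply
      (S.target.contDiffOn_covDeriv S.isOpen S.mapsTo S.smooth S.smooth_normal b)).clm_apply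
      (S.contDiffOn_fderiv b)
  have h2 : ContDiffOn ℝ ∞ (fun y => G y b b) U :=
    (S.domain.contDiffOn.clm_apply contDiffOn_const).clm_apply contDiffOn_const
  refine (h1.neg.div h2 hne).congr fun y hy => ?_
  rw [Pi.div_apply, S.weingarten hy, map_smul, smul_apply, S.isometric y hy, smul_eq_mul]
  have := hne y hy
  field_simp

theorem differentiableAt_meanCurvature (S : IsUmbilicalSurface G K F ν H U V) (hx : x ∈ U) :
    DifferentiableAt ℝ H x := S.contDiffOn_meanCurvature.differentiableAt_of_isOpen S.isOpen hx

/-- The Codazzi equation. -/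
theorem codazzi (S : IsUmbilicalSurface G K F ν H U V) (hx : x ∈ U) (u v : 𝔼 2) :
    curvature K (F x) (fderiv ℝ F x u) (fderiv ℝ F x v) (ν x) =
      fderiv ℝ H x v • fderiv ℝ F x u - fderiv ℝ H x u • fderiv ℝ F x v := by
  have h : ∀ u v, covDeriv K F (fun y => covDeriv K F ν y v) x u =
      -(fderiv ℝ H x u • fderiv ℝ F x v) - H x • covDeriv K F (fun y => fderiv ℝ F y v) x u := by
    intro u v
    have he : (fun y => covDeriv K F ν y v) =ᶠ[𝓝 x] fun y => -H y • fderiv ℝ F y v := by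
      filter_upwards [S.isOpen.mem_nhds hx] with y hy using S.weingarten hy v
    rw [covDeriv_congr he, covDeriv_smul (S.differentiableAt_meanCurvature hx).fun_neg
      ((S.contDiffOn_fderiv v).differentiableAt_of_isOpen S.isOpen hx), fderiv_fun_neg]
    simp only [neg_apply, neg_smul]
    abel
  -- Antisymmetrising ∇_u∇_v ν removes the term H ∇_u(dF v), which is symmetric in u and v.
  rw [← S.target.covDeriv_comm S.isOpen hx S.mapsTo S.smooth S.smooth_normal, h, h,
    S.target.covDeriv_fderiv_symm S.isOpen hx S.mapsTo S.smooth u v]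
  abel

/-- The trace is taken in the frame (ν, dF e₀, dF e₁); its normal term drops out because R(ν, ν) =
0. -/
theorem ricciForm_eq (S : IsUmbilicalSurface G K F ν H U V) (hx : x ∈ U) {e : Fin 2 → 𝔼 2}
    (he : IsFrame (G x) e) (z : 𝔼 3) :
    ricciForm K (F x) (ν x) z =
      ∑ i, K (F x) (curvature K (F x) (fderiv ℝ F x (e i)) (ν x) z) (fderiv ℝ F x (e i)) := by
  let T : 𝔼 3 →ₗ[ℝ] 𝔼 3 :=
    { toFun := fun u => curvature K (F x) u (ν x) z
      map_add' := fun u u' => curvature_add_left _ u u' _ _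
      map_smul' := fun r u => curvature_smul_left r _ u _ _ }
  have h1 : ricciForm K (F x) (ν x) z = ∑ i, coordForm i (T (basisVec i)) := by
    simp [ricciForm, T]
  have h0 : curvature K (F x) (ν x) (ν x) z = 0 := by
    simp [curvature]
  rw [h1, sum_coordForm_eq_sum (S.isFrame hx he) (by simp), Fin.sum_univ_succ]
  simp [T, h0]

/-- The Ricci tensor on the normal and a tangent vector is the derivative of the mean curvature. -/
theorem ricciForm_normal_tangent (S : IsUmbilicalSurface G K F ν H U V) (hx : x ∈ U) (w : 𝔼 2) :
    ricciForm K (F x) (ν x) (fderiv ℝ F x w) = fderiv ℝ H x w := by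
  obtain ⟨e, he⟩ := (S.domain.inner x hx).exists_frame
  have h : ∀ i, K (F x) (curvature K (F x) (fderiv ℝ F x (e i)) (ν x) (fderiv ℝ F x w))
      (fderiv ℝ F x (e i)) = fderiv ℝ H x w - fderiv ℝ H x (G x w (e i) • e i) := by
    intro i
    -- In the Bianchi sum paired with dF(eᵢ), skewness kills ⟨R(ν, w)eᵢ, eᵢ⟩, and Codazzi evaluates
    -- ⟨R(w, eᵢ)ν, eᵢ⟩. Pair symmetry of the curvature is not needed.
    have hb := S.target.curvature_bianchi (S.mapsTo hx) (fderiv ℝ F x (e i)) (ν x)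
      (fderiv ℝ F x w)
    have hs := S.target.curvature_skew (S.mapsTo hx) (ν x) (fderiv ℝ F x w)
      (fderiv ℝ F x (e i)) (fderiv ℝ F x (e i))
    rw [(S.innerAt hx).symm (fderiv ℝ F x (e i))] at hs
    have hb' := congrArg (fun z => K (F x) z (fderiv ℝ F x (e i))) hb
    simp only [map_add, add_apply, map_zero, zero_apply, S.codazzi hx, map_sub, sub_apply,
      map_smul, smul_apply, smul_eq_mul, S.isometric x hx] at hb'
    have h1 : G x (e i) (e i) = 1 := by simpa using he i i
    rw [h1] at hb'
    rw [map_smul, smul_eq_mul]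
    linarith
  -- The first terms add up to 2 dH(w) and the second to dH(w), by expanding w in the frame.
  rw [S.ricciForm_eq hx he, Finset.sum_congr rfl fun i _ => h i, Finset.sum_sub_distrib,
    ← map_sum (fderiv ℝ H x) (fun i => G x w (e i) • e i), he.sum_eq (by simp)]
  simp
  ring

/-- Skewness moves the curvature operator onto `z`, which identifies the curvature term of the
bitension field with minus the Ricci tensor. -/
theorem inner_metricTrace_curvature (S : IsUmbilicalSurface G K F ν H U V) (hx : x ∈ U) (z : 𝔼 3) :
    K (F x) (metricTrace (G x) (fun u v =>
      curvature K (F x) (fderiv ℝ F x u) (ν x) (fderiv ℝ F x v))) z =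
      -ricciForm K (F x) (ν x) z := by
  obtain ⟨e, he⟩ := (S.domain.inner x hx).exists_frame
  rw [S.ricciForm_eq hx he]
  have h := metricTrace_eq_sum (S.domain.inner x hx) he
    (LinearMap.mk₂ ℝ (fun u v => curvature K (F x) (fderiv ℝ F x u) (ν x) (fderiv ℝ F x v))
      (fun u u' v => by rw [map_add, curvature_add_left])
      (fun r u v => by rw [map_smul, curvature_smul_left]) (by simp) (by simp))
  simp only [LinearMap.mk₂_apply] at h
  rw [h, map_sum, sum_apply, ← Finset.sum_neg_distrib]
  refine Finset.sum_congr rfl fun i _ => ?_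
  rw [S.target.curvature_skew (S.mapsTo hx), (S.innerAt hx).symm]

variable {a : 𝔼 2 → ℝ}

theorem covDeriv_smul_normal (S : IsUmbilicalSurface G K F ν H U V) (ha : ContDiffOn ℝ ∞ a U)
    (hx : x ∈ U) (v : 𝔼 2) : covDeriv K F (fun y => a y • ν y) x v =
      fderiv ℝ a x v • ν x + -(a x * H x) • fderiv ℝ F x v := by
  rw [covDeriv_smul (ha.differentiableAt_of_isOpen S.isOpen hx) (S.differentiableAt_normal hx),
    S.weingarten hx, smul_smul, mul_neg]

/-- Apply the Weingarten equation twice. The Christoffel contributions along dF cancel, and the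
normal one completes the Hessian of `a`. The tangential terms are grouped as dF of
covector-times-vector expressions, ready for the trace. -/
theorem covDeriv₂_smul_normal (S : IsUmbilicalSurface G K F ν H U V) (ha : ContDiffOn ℝ ∞ a U)
    (hx : x ∈ U) (u v : 𝔼 2) : covDeriv₂ G K F (fun y => a y • ν y) x u v =
      hessian G a x u v • ν x - (a x * H x ^ 2) • G x u v • ν x
        - H x • fderiv ℝ F x (fderiv ℝ a x v • u)
        - fderiv ℝ F x (fderiv ℝ (fun y => a y * H y) x u • v) := by
  have hH := S.differentiableAt_meanCurvature hx
  have had := ha.differentiableAt_of_isOpen S.isOpen hx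
  have hF := (S.contDiffOn_fderiv v).differentiableAt_of_isOpen S.isOpen hx
  have hda : DifferentiableAt ℝ (fun y => fderiv ℝ a y v) x :=
    ((ha.fderiv_smooth S.isOpen).clm_apply contDiffOn_const).differentiableAt_of_isOpen S.isOpen hx
  have hn := S.differentiableAt_normal hx
  have he : (fun y => covDeriv K F (fun y => a y • ν y) y v) =ᶠ[𝓝 x]
      fun y => fderiv ℝ a y v • ν y + -(a y * H y) • fderiv ℝ F y v := by
    filter_upwards [S.isOpen.mem_nhds hx] with y hy using S.covDeriv_smul_normal ha hy v
  rw [covDeriv₂, S.covDeriv_smul_normal ha hx, covDeriv_congr he,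
    covDeriv_add (hda.fun_smul hn) ((had.fun_mul hH).fun_neg.fun_smul hF), covDeriv_smul hda hn,
    covDeriv_smul (had.fun_mul hH).fun_neg hF, S.weingarten hx, S.covDeriv_fderiv hx, fderiv_fun_neg,
    hessian]
  simp only [neg_apply, map_smul]
  module

theorem metricTrace_covDeriv₂_smul_normal (S : IsUmbilicalSurface G K F ν H U V)
    (ha : ContDiffOn ℝ ∞ a U) (hx : x ∈ U) :
    metricTrace (G x) (fun u v => covDeriv₂ G K F (fun y => a y • ν y) x u v) =
      (metricTrace (G x) (hessian G a x) - 2 * a x * H x ^ 2) • ν x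
        - fderiv ℝ F x ((G x).inverse
          (H x • fderiv ℝ a x + fderiv ℝ (fun y => a y * H y) x)) := by
  have hb := S.domain.inner x hx
  simp only [S.covDeriv₂_smul_normal ha hx]
  rw [metricTrace_sub, metricTrace_sub, metricTrace_sub, metricTrace_smul_const, metricTrace_smul,
    metricTrace_smul_const, metricTrace_self hb, metricTrace_smul]
  have h1 := metricTrace_map (b := G x) (fderiv ℝ F x : 𝔼 2 →ₗ[ℝ] 𝔼 3)
    (fun u v => fderiv ℝ a x v • u)
  have h2 := metricTrace_map (b := G x) (fderiv ℝ F x : 𝔼 2 →ₗ[ℝ] 𝔼 3)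
    (fun u v => fderiv ℝ (fun y => a y * H y) x u • v)
  rw [metricTrace_covector_smul' hb] at h1
  rw [metricTrace_covector_smul hb] at h2
  simp only [ContinuousLinearMap.coe_coe] at h1 h2
  rw [h1, h2]
  simp only [map_add, map_smul]
  module

theorem tension_eq (S : IsUmbilicalSurface G K F ν H U V) (hx : x ∈ U) :
    tension G K F x = (2 * H x) • ν x := by
  have : (secondFund G K F x) = fun u v => G x u v • (H x • ν x) := by
    funext u v
    rw [S.umbilical x hx, smul_smul]
  rw [tension, this, metricTrace_smul_const, metricTrace_self (S.domain.inner x hx), smul_smul]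
  simp

/-- The tension field with respect to a conformal metric. -/
theorem tension_conformal (S : IsUmbilicalSurface G K F ν H U V) (ha : ContDiffOn ℝ ∞ a U)
    (hpos : ∀ x ∈ U, 0 < a x) (hx : x ∈ U) :
    tension (fun x => a x • G x) K F x = (2 * (a x)⁻¹ * H x) • ν x := by
  have h := S.domain.metricTrace_smul_sub ha hpos hx
    (fun u v => covDeriv K F (fun y => fderiv ℝ F y v) x u) (fderiv ℝ F x : 𝔼 2 →ₗ[ℝ] 𝔼 3)
  refine h.trans ?_
  change (a x)⁻¹ • tension G K F x = _
  rw [S.tension_eq hx, smul_smul]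
  ring_nf

/-- The bitension field with respect to a conformal metric, in terms of the normal component `μ` of
the tension field. -/
theorem bitension_conformal (S : IsUmbilicalSurface G K F ν H U V) (ha : ContDiffOn ℝ ∞ a U)
    (hpos : ∀ x ∈ U, 0 < a x) (hx : x ∈ U) {μ : 𝔼 2 → ℝ}
    (hμ : ∀ y ∈ U, μ y = 2 * (a y)⁻¹ * H y) :
    bitension (fun x => a x • G x) K F x = (a x)⁻¹ •
      (metricTrace (G x) (fun u v => covDeriv₂ G K F (fun y => μ y • ν y) x u v)
        - μ x • metricTrace (G x) (fun u v =>
          curvature K (F x) (fderiv ℝ F x u) (ν x) (fderiv ℝ F x v))) := by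
  have he : tension (fun x => a x • G x) K F =ᶠ[𝓝 x] fun y => μ y • ν y := by
    filter_upwards [S.isOpen.mem_nhds hx] with y hy
    rw [S.tension_conformal ha hpos hy, hμ y hy]
  -- The tension field is differentiated twice, so its formula must be used on a neighbourhood of
  -- each nearby point, not only at x.
  have hc : ∀ v, (fun y => covDeriv K F (tension (fun x => a x • G x) K F) y v) =ᶠ[𝓝 x]
      fun y => covDeriv K F (fun y => μ y • ν y) y v := by
    intro v
    filter_upwards [he.eventuallyEq_nhds] with y hy using covDeriv_congr hy v
  let L : 𝔼 2 →ₗ[ℝ] 𝔼 3 :=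
    { toFun := fun u => covDeriv K F (fun y => μ y • ν y) x u
      map_add' := covDeriv_apply_add
      map_smul' := covDeriv_apply_smul }
  -- The field μν is now fixed, and V ↦ ∇_V(μν) is the linear map through which the Christoffel term
  -- enters; the two-dimensional trace identity therefore applies again.
  have h := S.domain.metricTrace_smul_sub ha hpos hx
    (fun u v => covDeriv K F (fun y => covDeriv K F (fun y => μ y • ν y) y v) x u) L
  rw [bitension, smul_sub, smul_smul]
  congr 1
  · refine Eq.trans ?_ h
    congr 1
    funext u v
    rw [covDeriv₂, covDeriv_congr (hc v), covDeriv_congr he]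
    rfl
  · rw [metricTrace_smul_metric (S.domain.inner x hx) (hpos x hx).ne', he.self_of_nhds, ← smul_smul,
      ← metricTrace_smul (μ x)]
    simp only [curvature_smul_right]

/-- The two conditions are the normal and tangential components of the bitension field, up to
nonzero factors. -/
theorem bitension_conformal_eq_zero_iff (S : IsUmbilicalSurface G K F ν H U V)
    (ha : ContDiffOn ℝ ∞ a U) (hpos : ∀ x ∈ U, 0 < a x) (hx : x ∈ U) {μ : 𝔼 2 → ℝ}
    (hμ : ∀ y ∈ U, μ y = 2 * (a y)⁻¹ * H y) :
    bitension (fun x => a x • G x) K F x = 0 ↔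
      metricTrace (G x) (hessian G μ x) + μ x * (ricciForm K (F x) (ν x) (ν x) - 2 * H x ^ 2) = 0 ∧
        ∀ w, H x * fderiv ℝ μ x w = 0 := by
  have hb := S.domain.inner x hx
  have hμs : ContDiffOn ℝ ∞ μ U := by
    refine ((contDiffOn_const (c := (2 : ℝ))).mul
      (ha.inv fun y hy => (hpos y hy).ne')).mul S.contDiffOn_meanCurvature |>.congr fun y hy => ?_
    simpa using hμ y hy
  rw [S.bitension_conformal ha hpos hx hμ, smul_eq_zero_iff_right (inv_ne_zero (hpos x hx).ne'),
    S.metricTrace_covDeriv₂_smul_normal hμs hx]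
  set R := metricTrace (G x) (fun u v =>
    curvature K (F x) (fderiv ℝ F x u) (ν x) (fderiv ℝ F x v)) with hR
  set Z := (metricTrace (G x) (hessian G μ x) - 2 * μ x * H x ^ 2) • ν x
        - fderiv ℝ F x ((G x).inverse
          (H x • fderiv ℝ μ x + fderiv ℝ (fun y => μ y * H y) x)) - μ x • R with hZ
  have h1 : K (F x) Z (ν x) = metricTrace (G x) (hessian G μ x)
      + μ x * (ricciForm K (F x) (ν x) (ν x) - 2 * H x ^ 2) := by
    simp only [hZ, map_sub, map_smul, sub_apply, smul_apply, smul_eq_mul, S.normal x hx,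
      S.unit x hx, hR, S.inner_metricTrace_curvature hx]
    ring
  -- The derivative terms give -(2H dμ + μ dH) and the Ricci term gives +μ dH, so only -2H dμ
  -- survives.
  have h2 : ∀ w, K (F x) Z (fderiv ℝ F x w) = -2 * (H x * fderiv ℝ μ x w) := by
    intro w
    simp only [hZ, map_sub, map_smul, sub_apply, smul_apply, smul_eq_mul, S.normal' hx,
      S.isometric x hx, hR, S.inner_metricTrace_curvature hx, hb.apply_inverse, add_apply,
      S.ricciForm_normal_tangent hx]
    rw [fderiv_fun_mul (hμs.differentiableAt_of_isOpen S.isOpen hx)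
      (S.differentiableAt_meanCurvature hx)]
    simp only [add_apply, smul_apply, smul_eq_mul]
    ring
  rw [← h1]
  constructor
  · intro h
    rw [h] at h2 ⊢
    refine ⟨by simp, fun w => ?_⟩
    have := h2 w
    simp only [map_zero, zero_apply] at this
    linarith
  · rintro ⟨h3, h4⟩
    apply S.ext hx
    · rw [h3]; simp
    · intro w
      rw [h2, h4]; simp

end IsUmbilicalSurface

end Surface

/-! ### Passage from manifolds to charts. -/

section Coordinates

variable {m n : ℕ} {M N : Type*} [TopologicalSpace M] [TopologicalSpace N]
  {e : OpenPartialHomeomorph M (𝔼 m)} {e' : OpenPartialHomeomorph N (𝔼 n)} {φ : M → N}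

theorem isOpen_mapIn_domain (hφ : Continuous φ) :
    IsOpen (e.target ∩ e.symm ⁻¹' (φ ⁻¹' e'.source)) :=
  e.isOpen_inter_preimage_symm (e'.open_source.preimage hφ)

theorem mapIn_apply {p : M} (hp : p ∈ e.source) : mapIn φ e e' (e p) = e' (φ p) := by
  rw [mapIn, e.left_inv hp]

theorem fieldIn_apply [ChartedSpace (𝔼 n) N] (X : ∀ p : M, TangentSpace (𝓡 n) (φ p)) {p : M} (hp : p ∈ e.source) :
    fieldIn X e e' (e p) = dChart e' (φ p) (X p) := by
  rw [fieldIn, e.left_inv hp]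

end Coordinates

section Charts

open Filter Topology Bundle

variable {m n : ℕ} {M N : Type*}
  [TopologicalSpace M] [ChartedSpace (𝔼 m) M] [IsManifold (𝓡 m) ∞ M]
  [TopologicalSpace N] [ChartedSpace (𝔼 n) N] [IsManifold (𝓡 n) ∞ N]
  {e : OpenPartialHomeomorph M (𝔼 m)} {e' : OpenPartialHomeomorph N (𝔼 n)}

theorem isManifold_one (m : ℕ) (M : Type*) [TopologicalSpace M] [ChartedSpace (𝔼 m) M]
    [IsManifold (𝓡 m) ∞ M] : IsManifold (𝓡 m) 1 M :=
  IsManifold.of_le (n := ∞) (by simp)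

theorem contMDiffOn_atlas (he : e ∈ atlas (𝔼 m) M) : ContMDiffOn (𝓡 m) (𝓡 m) ∞ e e.source :=
  contMDiffOn_of_mem_maximalAtlas (IsManifold.subset_maximalAtlas he)

theorem contMDiffOn_atlas_symm (he : e ∈ atlas (𝔼 m) M) :
    ContMDiffOn (𝓡 m) (𝓡 m) ∞ e.symm e.target :=
  contMDiffOn_symm_of_mem_maximalAtlas (IsManifold.subset_maximalAtlas he)

theorem mdifferentiable_atlas (he : e ∈ atlas (𝔼 m) M) : e.MDifferentiable (𝓡 m) (𝓡 m) := by
  have := isManifold_one m M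
  exact mdifferentiable_of_mem_atlas he

theorem dChart_dChartSymm (he : e ∈ atlas (𝔼 m) M) {x : 𝔼 m} (hx : x ∈ e.target) (u : 𝔼 m) :
    dChart e (e.symm x) (dChartSymm e x u) = u :=
  congrArg (fun L : 𝔼 m →L[ℝ] 𝔼 m => L u) ((mdifferentiable_atlas he).comp_symm_deriv hx)

theorem dChartSymm_dChart (he : e ∈ atlas (𝔼 m) M) {p : M} (hp : p ∈ e.source)
    (X : TangentSpace (𝓡 m) p) : (dChartSymm e (e p) (dChart e p X) : 𝔼 m) = X :=
  congrArg (fun L : 𝔼 m →L[ℝ] 𝔼 m => L X) ((mdifferentiable_atlas he).symm_comp_deriv hp)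

theorem dChart_isInvertible (he : e ∈ atlas (𝔼 m) M) {p : M} (hp : p ∈ e.source) :
    (dChart e p).IsInvertible :=
  ⟨(mdifferentiable_atlas he).mfderiv hp, rfl⟩

theorem metricAt_isInner (g : RMetric m M) (p : M) : IsInner (metricAt g p) :=
  ⟨g.symm p, g.pos p⟩

theorem metricIn_apply (g : RMetric m M) (x u v : 𝔼 m) :
    metricIn g e x u v = metricAt g (e.symm x) (dChartSymm e x u) (dChartSymm e x v) := rfl

theorem metricIn_dChart (g : RMetric m M) (he : e ∈ atlas (𝔼 m) M) {p : M} (hp : p ∈ e.source)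
    (X Y : TangentSpace (𝓡 m) p) :
    metricIn g e (e p) (dChart e p X) (dChart e p Y) = g.inner p X Y := by
  rw [metricIn_apply, e.left_inv hp]
  have hX := dChartSymm_dChart he hp X
  have hY := dChartSymm_dChart he hp Y
  exact congrArg₂ (fun X Y : 𝔼 m => metricAt g p X Y) hX hY

/-- Coordinate vector fields are smooth as maps into the tangent bundle; evaluating the metric on
them yields smoothness of `metricIn`. -/
theorem contMDiffOn_dChartSymm (he : e ∈ atlas (𝔼 m) M) (u : 𝔼 m) :
    ContMDiffOn (𝓡 m) (𝓡 m).tangent ∞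
      (fun x => (⟨e.symm x, dChartSymm e x u⟩ : TangentBundle (𝓡 m) M)) e.target := by
  have := isManifold_one m M
  have h1 := (contMDiffOn_atlas_symm he).contMDiffOn_tangentMapWithin (m := ∞) (by simp)
    e.open_target.uniqueMDiffOn
  have h2 : ContMDiff (𝓡 m) (𝓡 m).tangent ∞ (fun x : 𝔼 m => (⟨x, u⟩ : TangentBundle (𝓡 m) (𝔼 m))) := by
    intro x
    exact contMDiffAt_vectorSpace_iff_contDiffAt.mpr contDiffAt_const
  refine (h1.comp h2.contMDiffOn (fun x hx => hx)).congr fun x hx => ?_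
  simp only [Function.comp_apply, tangentMapWithin, dChartSymm]
  rw [mfderivWithin_of_isOpen e.open_target hx]
  rfl

theorem isMetricOn_metricIn (g : RMetric m M) (he : e ∈ atlas (𝔼 m) M) :
    IsMetricOn (metricIn g e) e.target where
  isOpen := e.open_target
  contDiffOn := by
    rw [contDiffOn_clm_apply]
    intro u
    rw [contDiffOn_clm_apply]
    intro v
    rw [← contMDiffOn_iff_contDiffOn]
    intro x hx
    have h : ContMDiffWithinAt (𝓡 m) ((𝓡 m).prod 𝓘(ℝ, ℝ)) ∞
        (fun x => TotalSpace.mk' ℝ (E := Bundle.Trivial M ℝ) (e.symm x)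
          (g.inner (e.symm x) (dChartSymm e x u) (dChartSymm e x v))) e.target x := by
      apply ContMDiffWithinAt.clm_bundle_apply₂ (F₁ := 𝔼 m) (F₂ := 𝔼 m)
      · exact g.contMDiff.contMDiffAt.comp_contMDiffWithinAt x (contMDiffOn_atlas_symm he x hx)
      · exact contMDiffOn_dChartSymm he u x hx
      · exact contMDiffOn_dChartSymm he v x hx
    simp only [contMDiffWithinAt_totalSpace] at h
    exact h.2
  inner x hx := by
    have hb := metricAt_isInner g (e.symm x)
    let L : 𝔼 m →L[ℝ] 𝔼 m := dChart e (e.symm x)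
    let L' : 𝔼 m →L[ℝ] 𝔼 m := dChartSymm e x
    have hL : ∀ u, L (L' u) = u := dChart_dChartSymm he hx
    have hG : ∀ u v, metricIn g e x u v = metricAt g (e.symm x) (L' u) (L' v) := fun u v => rfl
    refine ⟨fun u v => ?_, fun u hu => ?_⟩
    · rw [hG, hG, hb.symm]
    · rw [hG]
      refine hb.pos _ fun h0 => hu ?_
      rw [← hL u, h0, map_zero]

variable {φ : M → N}

theorem contDiffOn_mapIn (hφ : ContMDiff (𝓡 m) (𝓡 n) ∞ φ) (he : e ∈ atlas (𝔼 m) M)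
    (he' : e' ∈ atlas (𝔼 n) N) :
    ContDiffOn ℝ ∞ (mapIn φ e e') (e.target ∩ e.symm ⁻¹' (φ ⁻¹' e'.source)) := by
  rw [← contMDiffOn_iff_contDiffOn]
  exact (contMDiffOn_atlas he').comp
    (hφ.comp_contMDiffOn ((contMDiffOn_atlas_symm he).mono Set.inter_subset_left))
    (fun x hx => hx.2)

theorem contDiffOn_fieldIn (he : e ∈ atlas (𝔼 m) M) (he' : e' ∈ atlas (𝔼 n) N)
    {X : ∀ p : M, TangentSpace (𝓡 n) (φ p)}
    (hX : ContMDiff (𝓡 m) (𝓡 n).tangent ∞ (fun p => (⟨φ p, X p⟩ : TangentBundle (𝓡 n) N))) :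
    ContDiffOn ℝ ∞ (fieldIn X e e') (e.target ∩ e.symm ⁻¹' (φ ⁻¹' e'.source)) := by
  have := isManifold_one n N
  rw [← contMDiffOn_iff_contDiffOn]
  have h1 := (contMDiffOn_atlas he').contMDiffOn_tangentMapWithin (m := ∞) (by simp)
    e'.open_source.uniqueMDiffOn
  have h2 := hX.comp_contMDiffOn ((contMDiffOn_atlas_symm he).mono
    (Set.inter_subset_left (t := e.symm ⁻¹' (φ ⁻¹' e'.source))))
  have h3 := (contMDiff_snd_tangentBundle_modelSpace (n := ∞) (𝔼 n) (𝓡 n)).comp_contMDiffOn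
    (h1.comp h2 (fun x hx => hx.2))
  refine h3.congr fun x hx => ?_
  exact congrArg (fun L : 𝔼 n →L[ℝ] 𝔼 n => L (X (e.symm x)))
    (mfderivWithin_of_isOpen (I := 𝓡 n) (I' := 𝓡 n) (f := e') e'.open_source hx.2).symm

theorem fderiv_mapIn (hφ : ContMDiff (𝓡 m) (𝓡 n) ∞ φ) (he : e ∈ atlas (𝔼 m) M)
    (he' : e' ∈ atlas (𝔼 n) N) {p : M} (hp : p ∈ e.source) (hp' : φ p ∈ e'.source)
    (X : TangentSpace (𝓡 m) p) :
    fderiv ℝ (mapIn φ e e') (e p) (dChart e p X) = dChart e' (φ p) (mfderiv (𝓡 m) (𝓡 n) φ p X) := by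
  have hmem : e p ∈ e.target ∩ e.symm ⁻¹' (φ ⁻¹' e'.source) := by
    refine ⟨e.map_source hp, ?_⟩
    simpa [e.left_inv hp] using hp'
  have h1 : MDifferentiableAt (𝓡 m) (𝓡 n) (mapIn φ e e') (e p) :=
    ((contDiffOn_mapIn hφ he he').differentiableAt_of_isOpen (isOpen_mapIn_domain hφ.continuous)
      hmem).mdifferentiableAt
  have h2 := (mdifferentiable_atlas he).mdifferentiableAt hp
  have h3 := (mdifferentiable_atlas he').mdifferentiableAt hp'
  have h4 : MDifferentiableAt (𝓡 m) (𝓡 n) φ p := hφ.mdifferentiableAt (by simp)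
  have h5 : mapIn φ e e' ∘ e =ᶠ[𝓝 p] e' ∘ φ := by
    filter_upwards [e.open_source.mem_nhds hp] with q hq using mapIn_apply hq
  have h6 := (h5.mfderiv_eq (I := 𝓡 m) (I' := 𝓡 n))
  rw [mfderiv_comp p h1 h2, mfderiv_comp p h3 h4, mfderiv_eq_fderiv] at h6
  exact congrArg (fun L : 𝔼 m →L[ℝ] 𝔼 n => L X) h6

/-- Differentiability is part of the conclusion: without it, a vanishing `mfderiv` could be just the
default value and would not imply local constancy. -/
theorem mfderiv_eq_fderiv_chart (he : e ∈ atlas (𝔼 m) M) {u : M → ℝ} {p : M} (hp : p ∈ e.source)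
    (hu : DifferentiableAt ℝ (fun x => u (e.symm x)) (e p)) (X : TangentSpace (𝓡 m) p) :
    MDifferentiableAt (𝓡 m) 𝓘(ℝ, ℝ) u p ∧
    (mfderiv (𝓡 m) 𝓘(ℝ, ℝ) u p X : ℝ) =
      fderiv ℝ (fun x => u (e.symm x)) (e p) (dChart e p X) := by
  have h1 : MDifferentiableAt (𝓡 m) 𝓘(ℝ, ℝ) (fun x => u (e.symm x)) (e p) := hu.mdifferentiableAt
  have h2 := (mdifferentiable_atlas he).mdifferentiableAt hp
  have h5 : u =ᶠ[𝓝 p] (fun x => u (e.symm x)) ∘ e := by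
    filter_upwards [e.open_source.mem_nhds hp] with q hq
    simp [e.left_inv hq]
  refine ⟨(h1.comp p h2).congr_of_eventuallyEq h5, ?_⟩
  have h6 := (h5.mfderiv_eq (I := 𝓡 m) (I' := 𝓘(ℝ, ℝ)))
  rw [mfderiv_comp p h1 h2, mfderiv_eq_fderiv] at h6
  exact congrArg (fun L : 𝔼 m →L[ℝ] ℝ => L X) h6

/-- In a chart, restrict to a ball inside the target: it is convex, so a zero derivative forces
constancy there. -/
theorem isLocallyConstant_of_mfderiv_eq_zero {u : M → ℝ}
    (hu : MDifferentiable (𝓡 m) 𝓘(ℝ, ℝ) u) (h : ∀ p, mfderiv (𝓡 m) 𝓘(ℝ, ℝ) u p = 0) :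
    IsLocallyConstant u := by
  rw [IsLocallyConstant.iff_eventually_eq]
  intro p
  set e := chartAt (𝔼 m) p with he
  have hat : e ∈ atlas (𝔼 m) M := chart_mem_atlas _ p
  have hp : p ∈ e.source := mem_chart_source _ p
  have hd : ∀ x ∈ e.target, HasFDerivAt (fun x => u (e.symm x)) (0 : 𝔼 m →L[ℝ] ℝ) x := by
    intro x hx
    have h1 := (hu (e.symm x)).hasMFDerivAt.comp x
      ((mdifferentiable_atlas hat).mdifferentiableAt_symm hx).hasMFDerivAt
    rw [h] at h1
    have h2 := h1.hasFDerivAt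
    exact h2.congr_fderiv (by ext v; rfl)
  obtain ⟨ε, hε, hb⟩ := Metric.isOpen_iff.mp e.open_target _ (e.map_source hp)
  have hmem : e.source ∩ e ⁻¹' Metric.ball (e p) ε ∈ 𝓝 p :=
    (e.isOpen_inter_preimage Metric.isOpen_ball).mem_nhds ⟨hp, Metric.mem_ball_self hε⟩
  filter_upwards [hmem] with q hq
  have := (convex_ball (e p) ε).is_const_of_fderivWithin_eq_zero (𝕜 := ℝ)
    (f := fun x => u (e.symm x))
    (fun x hx => (hd x (hb hx)).differentiableAt.differentiableWithinAt)
    (fun x hx => (hd x (hb hx)).hasFDerivWithinAt.fderivWithin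
      (Metric.isOpen_ball.uniqueDiffWithinAt hx)) hq.2 (Metric.mem_ball_self hε)
  simpa [e.left_inv hp, e.left_inv hq.1] using this

end Charts

/-! ### Umbilical immersions of manifolds, read in charts. -/

section UmbilicalImmersion

open Filter Topology

variable {M N : Type*}
  [TopologicalSpace M] [ChartedSpace (𝔼 2) M] [IsManifold (𝓡 2) ∞ M]
  [TopologicalSpace N] [ChartedSpace (𝔼 3) N] [IsManifold (𝓡 3) ∞ N]

/-- A totally umbilical isometric immersion with unit normal `ξ` and mean curvature `H`. -/
structure IsUmbilicalImmersion (g : RMetric 2 M) (h : RMetric 3 N) (φ : M → N)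
    (ξ : ∀ p : M, TangentSpace (𝓡 3) (φ p)) (H : M → ℝ) : Prop where
  immersion : IsIsometricImmersion g h φ
  unitNormal : IsUnitNormal 2 h φ ξ
  meanCurvature : IsMeanCurvature g h φ ξ H
  umbilical : IsTotallyUmbilical g h φ

variable {g : RMetric 2 M} {h : RMetric 3 N} {φ : M → N}
  {ξ : ∀ p : M, TangentSpace (𝓡 3) (φ p)} {H : M → ℝ}
  {e : OpenPartialHomeomorph M (𝔼 2)} {e' : OpenPartialHomeomorph N (𝔼 3)}

namespace IsUmbilicalImmersion

/-- One fixed pair of charts must serve all points of the overlap domain, since the bitension at a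
point involves the tension field nearby. This is where the hypotheses for arbitrary atlas charts are
used. -/
theorem surface (S : IsUmbilicalImmersion g h φ ξ H) (he : e ∈ atlas (𝔼 2) M)
    (he' : e' ∈ atlas (𝔼 3) N) :
    IsUmbilicalSurface (metricIn g e) (metricIn h e') (mapIn φ e e') (fieldIn ξ e e')
      (fun x => H (e.symm x)) (e.target ∩ e.symm ⁻¹' (φ ⁻¹' e'.source)) e'.target := by
  have hφ := S.immersion.1
  have hU : IsOpen (e.target ∩ e.symm ⁻¹' (φ ⁻¹' e'.source)) := isOpen_mapIn_domain hφ.continuous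
  have hG := isMetricOn_metricIn g he
  have hpt : ∀ x ∈ e.target ∩ e.symm ⁻¹' (φ ⁻¹' e'.source),
      ∃ q, q ∈ e.source ∧ φ q ∈ e'.source ∧ e q = x :=
    fun x hx => ⟨e.symm x, e.map_target hx.1, hx.2, e.right_inv hx.1⟩
  have hvec : ∀ q ∈ e.source, ∀ u : 𝔼 2, ∃ X : TangentSpace (𝓡 2) q, dChart e q X = u :=
    fun q hq u => (dChart_isInvertible he hq).surjective u
  refine ⟨⟨hU, hG.contDiffOn.mono Set.inter_subset_left, fun x hx => hG.inner x hx.1⟩,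
    isMetricOn_metricIn h he', fun x hx => e'.map_source hx.2, contDiffOn_mapIn hφ he he',
    contDiffOn_fieldIn he he' S.unitNormal.1, ?_, ?_, ?_, ?_⟩
  · intro x hx u v
    obtain ⟨q, hq, hq', rfl⟩ := hpt x hx
    obtain ⟨X, rfl⟩ := hvec q hq u
    obtain ⟨Y, rfl⟩ := hvec q hq v
    rw [fderiv_mapIn hφ he he' hq hq', fderiv_mapIn hφ he he' hq hq', mapIn_apply hq,
      metricIn_dChart h he' hq', metricIn_dChart g he hq, S.immersion.2]
  · intro x hx
    obtain ⟨q, hq, hq', rfl⟩ := hpt x hx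
    rw [mapIn_apply hq, fieldIn_apply ξ hq, metricIn_dChart h he' hq', S.unitNormal.2.1]
  · intro x hx u
    obtain ⟨q, hq, hq', rfl⟩ := hpt x hx
    obtain ⟨X, rfl⟩ := hvec q hq u
    rw [fderiv_mapIn hφ he he' hq hq', mapIn_apply hq, fieldIn_apply ξ hq,
      metricIn_dChart h he' hq', S.unitNormal.2.2]
  · intro x hx u v
    obtain ⟨q, hq, hq', rfl⟩ := hpt x hx
    rw [S.umbilical e he e' he' q hq hq', S.meanCurvature e he e' he' q hq hq',
      fieldIn_apply ξ hq, e.left_inv hq, smul_smul]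

/-- The surface in the preferred charts at `p` and `φ p`. -/
theorem surfaceAt (S : IsUmbilicalImmersion g h φ ξ H) (p : M) :
    IsUmbilicalSurface (metricIn g (chartAt (𝔼 2) p)) (metricIn h (chartAt (𝔼 3) (φ p)))
      (mapIn φ (chartAt (𝔼 2) p) (chartAt (𝔼 3) (φ p)))
      (fieldIn ξ (chartAt (𝔼 2) p) (chartAt (𝔼 3) (φ p)))
      (fun x => H ((chartAt (𝔼 2) p).symm x))
      ((chartAt (𝔼 2) p).target ∩
        (chartAt (𝔼 2) p).symm ⁻¹' (φ ⁻¹' (chartAt (𝔼 3) (φ p)).source))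
      (chartAt (𝔼 3) (φ p)).target :=
  S.surface (chart_mem_atlas _ p) (chart_mem_atlas _ (φ p))


end IsUmbilicalImmersion

end UmbilicalImmersion

section Coordinates

variable {M N : Type*} [TopologicalSpace M] [ChartedSpace (𝔼 2) M]
  [TopologicalSpace N] [ChartedSpace (𝔼 3) N]

theorem mem_mapIn_domain (φ : M → N) (p : M) :
    chartAt (𝔼 2) p p ∈ (chartAt (𝔼 2) p).target ∩
      (chartAt (𝔼 2) p).symm ⁻¹' (φ ⁻¹' (chartAt (𝔼 3) (φ p)).source) := by
  refine ⟨mem_chart_target _ p, ?_⟩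
  simp

/-- Both sides use the preferred chart at φ p, so no change of coordinates for the Ricci tensor is
involved. -/
theorem ricci_normal_normal [IsManifold (𝓡 3) ∞ N] (h : RMetric 3 N) {φ : M → N}
    (ξ : ∀ p : M, TangentSpace (𝓡 3) (φ p)) (p : M) :
    ricci h (φ p) (ξ p) (ξ p) = ricciForm (metricIn h (chartAt (𝔼 3) (φ p)))
      (mapIn φ (chartAt (𝔼 2) p) (chartAt (𝔼 3) (φ p)) (chartAt (𝔼 2) p p))
      (fieldIn ξ (chartAt (𝔼 2) p) (chartAt (𝔼 3) (φ p)) (chartAt (𝔼 2) p p))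
      (fieldIn ξ (chartAt (𝔼 2) p) (chartAt (𝔼 3) (φ p)) (chartAt (𝔼 2) p p)) := by
  have hp := mem_chart_source (𝔼 2) p
  rw [mapIn_apply hp, fieldIn_apply ξ hp]
  rfl

end Coordinates

/-! ### Intrinsic form of the equations and consequences of connectedness. -/

section UmbilicalImmersion

open Filter Topology

variable {M N : Type*}
  [TopologicalSpace M] [ChartedSpace (𝔼 2) M] [IsManifold (𝓡 2) ∞ M]
  [TopologicalSpace N] [ChartedSpace (𝔼 3) N] [IsManifold (𝓡 3) ∞ N]

variable {g : RMetric 2 M} {h : RMetric 3 N} {φ : M → N}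
  {ξ : ∀ p : M, TangentSpace (𝓡 3) (φ p)} {H : M → ℝ}

/-- The differential of a function as a covector of the model space. -/
noncomputable def differential (u : M → ℝ) (p : M) : 𝔼 2 →L[ℝ] ℝ := mfderiv (𝓡 2) 𝓘(ℝ, ℝ) u p

theorem grad_eq_zero_iff (u : M → ℝ) (p : M) :
    grad g u p = 0 ↔ differential u p = 0 := by
  have hb := (metricAt_isInner g p).isInvertible.inverse.injective
  constructor
  · intro hu
    exact hb (hu.trans (map_zero (metricAt g p).inverse).symm)
  · intro (hu : mfderiv (𝓡 2) 𝓘(ℝ, ℝ) u p = 0)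
    rw [grad, hu]
    exact map_zero (metricAt g p).inverse

namespace IsUmbilicalImmersion

theorem mfderiv_meanCurvature (S : IsUmbilicalImmersion g h φ ξ H) (p : M)
    (X : TangentSpace (𝓡 2) p) :
    MDifferentiableAt (𝓡 2) 𝓘(ℝ, ℝ) H p ∧ differential H p X =
      fderiv ℝ (fun x => H ((chartAt (𝔼 2) p).symm x)) (chartAt (𝔼 2) p p)
        (dChart (chartAt (𝔼 2) p) p X) :=
  mfderiv_eq_fderiv_chart (chart_mem_atlas _ p) (mem_chart_source _ p)
    ((S.surfaceAt p).differentiableAt_meanCurvature (mem_mapIn_domain φ p)) X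

theorem ricci_normal_tangent (S : IsUmbilicalImmersion g h φ ξ H) (p : M)
    (X : TangentSpace (𝓡 2) p) :
    ricci h (φ p) (ξ p) (mfderiv (𝓡 2) (𝓡 3) φ p X) = differential H p X := by
  have hp := mem_chart_source (𝔼 2) p
  have h1 := (S.surfaceAt p).ricciForm_normal_tangent (mem_mapIn_domain φ p)
    (dChart (chartAt (𝔼 2) p) p X)
  rw [fderiv_mapIn S.immersion.1 (chart_mem_atlas _ p) (chart_mem_atlas _ (φ p)) hp
    (mem_chart_source _ _), mapIn_apply hp, fieldIn_apply ξ hp] at h1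
  rw [(S.mfderiv_meanCurvature p X).2, ← h1]
  rfl

/-- Both sides are metric duals of covectors, and these agree by the Codazzi computation of Ric(ξ,
dφ X). -/
theorem tangential_ricciOp (S : IsUmbilicalImmersion g h φ ξ H) (p : M) :
    tangential g h φ p (ricciOp h (φ p) (ξ p)) = grad g H p := by
  rw [tangential, grad]
  congr 1
  ext X
  have h1 : h.inner (φ p) (ricciOp h (φ p) (ξ p)) = ricci h (φ p) (ξ p) :=
    (metricAt_isInner h (φ p)).apply_inverse _
  rw [h1]
  exact S.ricci_normal_tangent p X

theorem covDerivAlong_normal (S : IsUmbilicalImmersion g h φ ξ H) (p : M)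
    (X : TangentSpace (𝓡 2) p) :
    covDerivAlong h φ ξ p X = -H p • mfderiv (𝓡 2) (𝓡 3) φ p X := by
  have hp := mem_chart_source (𝔼 2) p
  have h1 := (S.surfaceAt p).weingarten (mem_mapIn_domain φ p) (dChart (chartAt (𝔼 2) p) p X)
  rw [fderiv_mapIn S.immersion.1 (chart_mem_atlas _ p) (chart_mem_atlas _ (φ p)) hp
    (mem_chart_source _ _), (chartAt (𝔼 2) p).left_inv hp] at h1
  rw [covDerivAlong, h1, map_smul]
  congr 1
  exact (dChart_isInvertible (chart_mem_atlas _ (φ p)) (mem_chart_source _ _)).inverse_apply_self _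

theorem shapeOperator_eq (S : IsUmbilicalImmersion g h φ ξ H) (p : M)
    (X : TangentSpace (𝓡 2) p) : shapeOperator g h φ ξ p X = H p • X := by
  have h1 : (h.inner (φ p) (-H p • mfderiv (𝓡 2) (𝓡 3) φ p X)).comp (mfderiv (𝓡 2) (𝓡 3) φ p) =
      -H p • g.inner p X := by
    ext Y
    rw [map_smul]
    exact congrArg (fun r => -H p * r) (S.immersion.2 p X Y)
  have h2 : (metricAt g p).inverse (metricAt g p X) = X := (metricAt_isInner g p).inverse_apply X
  rw [shapeOperator, S.covDerivAlong_normal, tangential, h1, map_smul, neg_smul, neg_neg]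
  exact congrArg (fun Y : 𝔼 2 => H p • Y) h2

theorem shapeNormSq_eq (S : IsUmbilicalImmersion g h φ ξ H) (p : M) :
    shapeNormSq g h φ ξ p = 2 * H p ^ 2 := by
  have h1 : ∀ X Y : 𝔼 2, metricAt g p (shapeOperator g h φ ξ p X) (shapeOperator g h φ ξ p Y) =
      (H p ^ 2) • metricAt g p X Y := by
    intro X Y
    have hA : ∀ X : 𝔼 2, (shapeOperator g h φ ξ p X : 𝔼 2) = H p • X := S.shapeOperator_eq p
    rw [hA, hA, map_smul, map_smul, smul_apply, smul_eq_mul, smul_eq_mul, smul_eq_mul]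
    ring
  rw [shapeNormSq]
  simp only [h1]
  rw [metricTrace_smul, metricTrace_self (metricAt_isInner g p)]
  simp [mul_comm]

variable {f : M → ℝ} {hf : ContMDiff (𝓡 2) 𝓘(ℝ, ℝ) ∞ f} {hpos : ∀ p, 0 < f p}

theorem contDiffOn_weight (hf : ContMDiff (𝓡 2) 𝓘(ℝ, ℝ) ∞ f) (p : M) :
    ContDiffOn ℝ ∞ (fun x => f ((chartAt (𝔼 2) p).symm x)) (chartAt (𝔼 2) p).target := by
  rw [← contMDiffOn_iff_contDiffOn]
  exact hf.comp_contMDiffOn (contMDiffOn_atlas_symm (chart_mem_atlas _ p))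

theorem mfderiv_mul_meanCurvature (S : IsUmbilicalImmersion g h φ ξ H)
    (hf : ContMDiff (𝓡 2) 𝓘(ℝ, ℝ) ∞ f) (p : M) (X : TangentSpace (𝓡 2) p) :
    MDifferentiableAt (𝓡 2) 𝓘(ℝ, ℝ) (fun q => f q * H q) p ∧
    differential (fun q => f q * H q) p X =
      fderiv ℝ (fun x => f ((chartAt (𝔼 2) p).symm x) * H ((chartAt (𝔼 2) p).symm x))
        (chartAt (𝔼 2) p p) (dChart (chartAt (𝔼 2) p) p X) :=
  mfderiv_eq_fderiv_chart (u := fun q => f q * H q) (chart_mem_atlas _ p) (mem_chart_source _ p)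
    (((contDiffOn_weight hf p).differentiableAt_of_isOpen (chartAt (𝔼 2) p).open_target
      (mem_chart_target _ p)).fun_mul
      ((S.surfaceAt p).differentiableAt_meanCurvature (mem_mapIn_domain φ p))) X

/-- The coordinate criterion with a = f⁻¹ and μ = 2fH. The normal equation is left in the chart,
because it is needed only when fH is constant and the Hessian vanishes; the tangential one is stated
on M. -/
theorem bitension_eq_zero_iff (S : IsUmbilicalImmersion g h φ ξ H) (p : M) :
    bitension (metricIn (conformalMetric g f hf hpos) (chartAt (𝔼 2) p))
      (metricIn h (chartAt (𝔼 3) (φ p)))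
      (mapIn φ (chartAt (𝔼 2) p) (chartAt (𝔼 3) (φ p))) (chartAt (𝔼 2) p p) = 0 ↔
    metricTrace (metricIn g (chartAt (𝔼 2) p) (chartAt (𝔼 2) p p))
      (hessian (metricIn g (chartAt (𝔼 2) p)) (fun x => 2 * (f ((chartAt (𝔼 2) p).symm x) *
        H ((chartAt (𝔼 2) p).symm x))) (chartAt (𝔼 2) p p)) +
      2 * (f p * H p) * (ricci h (φ p) (ξ p) (ξ p) - 2 * H p ^ 2) = 0 ∧
    ∀ X : TangentSpace (𝓡 2) p,
      H p * differential (fun q => f q * H q) p X = 0 := by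
  have hp := mem_chart_source (𝔼 2) p
  have hw : ContDiffOn ℝ ∞ (fun x => f ((chartAt (𝔼 2) p).symm x))
      ((chartAt (𝔼 2) p).target ∩
        (chartAt (𝔼 2) p).symm ⁻¹' (φ ⁻¹' (chartAt (𝔼 3) (φ p)).source)) :=
    (contDiffOn_weight hf p).mono Set.inter_subset_left
  have h1 := (S.surfaceAt p).bitension_conformal_eq_zero_iff
    (a := fun x => (f ((chartAt (𝔼 2) p).symm x))⁻¹)
    (hw.inv fun y _ => (hpos _).ne') (fun y _ => inv_pos.mpr (hpos _)) (mem_mapIn_domain φ p)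
    (μ := fun x => 2 * (f ((chartAt (𝔼 2) p).symm x) * H ((chartAt (𝔼 2) p).symm x)))
    (fun y _ => by rw [inv_inv]; ring)
  -- Scaling commutes with pulling back by the same chart differential, so the equality holds at
  -- every x, even outside the chart target.
  have h2 : metricIn (conformalMetric g f hf hpos) (chartAt (𝔼 2) p) =
      fun x => (f ((chartAt (𝔼 2) p).symm x))⁻¹ • metricIn g (chartAt (𝔼 2) p) x := by
    funext x
    rfl
  rw [h2, h1, ricci_normal_normal]
  simp only [(chartAt (𝔼 2) p).left_inv hp]
  refine and_congr_right fun _ => ?_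
  have hd : DifferentiableAt ℝ
      (fun x => f ((chartAt (𝔼 2) p).symm x) * H ((chartAt (𝔼 2) p).symm x))
      (chartAt (𝔼 2) p p) :=
    (hw.differentiableAt_of_isOpen (S.surfaceAt p).isOpen (mem_mapIn_domain φ p)).fun_mul
      ((S.surfaceAt p).differentiableAt_meanCurvature (mem_mapIn_domain φ p))
  constructor
  · intro h3 X
    have h4 := h3 (dChart (chartAt (𝔼 2) p) p X)
    rw [fderiv_const_mul hd, smul_apply, ← (S.mfderiv_mul_meanCurvature hf p X).2,
      smul_eq_mul] at h4
    linarith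
  · intro h3 w
    obtain ⟨X, rfl⟩ := (dChart_isInvertible (chart_mem_atlas _ p) hp).surjective w
    rw [fderiv_const_mul hd, smul_apply, ← (S.mfderiv_mul_meanCurvature hf p X).2,
      smul_eq_mul, mul_left_comm, h3, mul_zero]

/-- If `f H` is constant, the conformal immersion is biharmonic exactly when the normal equation
without Laplacian holds. -/
theorem isBiharmonic_iff_of_const (S : IsUmbilicalImmersion g h φ ξ H) {c : ℝ}
    (hc : ∀ p, f p * H p = c) : IsBiharmonic (conformalMetric g f hf hpos) h φ ↔
      ∀ p, c * (ricci h (φ p) (ξ p) (ξ p) - 2 * H p ^ 2) = 0 := by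
  refine forall_congr' fun p => ?_
  rw [S.bitension_eq_zero_iff]
  simp only [hc]
  have h1 : hessian (metricIn g (chartAt (𝔼 2) p)) (fun _ => 2 * c) (chartAt (𝔼 2) p p) =
      fun _ _ => (0 : ℝ) := by
    funext u v
    simp [hessian]
  have h2 : differential (fun _ : M => c) p = 0 := mfderiv_const
  rw [h1, h2]
  have h3 : metricTrace (metricIn g (chartAt (𝔼 2) p) (chartAt (𝔼 2) p p))
      (fun _ _ => (0 : ℝ)) = 0 := by simp [metricTrace]
  rw [h3, zero_add, mul_assoc, mul_eq_zero_iff_left (two_ne_zero : (2 : ℝ) ≠ 0)]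
  exact and_iff_left fun X => mul_zero _

theorem isTotallyGeodesic_iff (S : IsUmbilicalImmersion g h φ ξ H) :
    IsTotallyGeodesic g h φ ↔ ∀ p, H p = 0 := by
  constructor
  · intro hT p
    have hp := mem_chart_source (𝔼 2) p
    have hx := mem_mapIn_domain φ p
    have Sp := S.surfaceAt p
    have h1 := Sp.tension_eq hx
    have h2 : secondFund (metricIn g (chartAt (𝔼 2) p)) (metricIn h (chartAt (𝔼 3) (φ p)))
        (mapIn φ (chartAt (𝔼 2) p) (chartAt (𝔼 3) (φ p))) (chartAt (𝔼 2) p p) =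
        fun _ _ => 0 := by
      funext u v
      exact hT _ (chart_mem_atlas _ p) _ (chart_mem_atlas _ (φ p)) p hp (mem_chart_source _ _) u v
    have h3 := congrArg (fun Z => metricIn h (chartAt (𝔼 3) (φ p))
      (mapIn φ (chartAt (𝔼 2) p) (chartAt (𝔼 3) (φ p)) (chartAt (𝔼 2) p p))
      Z (fieldIn ξ (chartAt (𝔼 2) p) (chartAt (𝔼 3) (φ p)) (chartAt (𝔼 2) p p))) h1
    rw [tension, h2] at h3
    simpa [metricTrace, Sp.unit _ hx, (chartAt (𝔼 2) p).left_inv hp] using h3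
  · intro hH e he e' he' p hp hp' u v
    rw [S.umbilical e he e' he' p hp hp', S.meanCurvature e he e' he' p hp hp', hH, zero_smul,
      smul_zero]

/-- On a connected surface, biharmonicity forces `(f H)²` to be constant. -/
theorem exists_sq_const_of_isBiharmonic [ConnectedSpace M] (S : IsUmbilicalImmersion g h φ ξ H)
    (hb : IsBiharmonic (conformalMetric g f hf hpos) h φ) :
    ∃ c, ∀ p, (f p * H p) ^ 2 = c := by
  -- The tangent vector 0 is a dummy argument; only the differentiability half is used.
  have hd := fun p => (S.mfderiv_mul_meanCurvature hf p 0).1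
  have hsq : ∀ p, HasMFDerivAt (𝓡 2) 𝓘(ℝ, ℝ) (fun q => (f q * H q) ^ 2) p
      (0 : TangentSpace (𝓡 2) p →L[ℝ] ℝ) := by
    intro p
    have h1 : HasFDerivAt (fun t : ℝ => t ^ 2)
        (ContinuousLinearMap.toSpanSingleton ℝ (2 * (f p * H p))) (f p * H p) := by
      simpa using (hasDerivAt_pow 2 (f p * H p)).hasFDerivAt
    have h2 := h1.hasMFDerivAt.comp p (hd p).hasMFDerivAt
    have h3 := ((S.bitension_eq_zero_iff (hf := hf) (hpos := hpos) p).mp (hb p)).2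
    have h4 : (ContinuousLinearMap.toSpanSingleton ℝ (2 * (f p * H p))).comp
        (differential (fun q => f q * H q) p) = 0 := by
      ext X
      have h5 := h3 X
      have h6 : differential (fun q => f q * H q) p X * (2 * (f p * H p)) = 0 := by
        -- d((fH)²) = 2fH d(fH) is 2f times the tangential equation H d(fH) = 0.
        linear_combination 2 * f p * h5
      exact h6
    exact h4 ▸ h2
  have hl : IsLocallyConstant (fun q => (f q * H q) ^ 2) :=
    isLocallyConstant_of_mfderiv_eq_zero (m := 2) (fun p => (hsq p).mdifferentiableAt)
      fun p => (hsq p).mfderiv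
  obtain ⟨p₀⟩ := (inferInstance : Nonempty M)
  exact ⟨_, fun p => hl.apply_eq_of_preconnectedSpace p p₀⟩

theorem exists_const_of_grad_eq_zero [ConnectedSpace M] (S : IsUmbilicalImmersion g h φ ξ H)
    (hf : ContMDiff (𝓡 2) 𝓘(ℝ, ℝ) ∞ f) (hg : ∀ p, grad g (fun q => f q * H q) p = 0) :
    ∃ c, ∀ p, f p * H p = c := by
  have hl : IsLocallyConstant (fun q => f q * H q) :=
    isLocallyConstant_of_mfderiv_eq_zero (m := 2) (fun p => (S.mfderiv_mul_meanCurvature hf p 0).1)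
      fun p => (grad_eq_zero_iff _ p).mp (hg p)
  obtain ⟨p₀⟩ := (inferInstance : Nonempty M)
  exact ⟨_, fun p => hl.apply_eq_of_preconnectedSpace p p₀⟩

end IsUmbilicalImmersion

end UmbilicalImmersion

end BiharmonicSurface

/-! ### The classification. -/

open BiharmonicSurface in
theorem mainTheorem1 {M N : Type*}
    [TopologicalSpace M] [ChartedSpace (𝔼 2) M] [IsManifold (𝓡 2) ∞ M] [ConnectedSpace M]
    [TopologicalSpace N] [ChartedSpace (𝔼 3) N] [IsManifold (𝓡 3) ∞ N]
    (g : RMetric 2 M) (h : RMetric 3 N) (φ : M → N) (hφ : IsIsometricImmersion g h φ)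
    (ξ : ∀ p : M, TangentSpace (𝓡 3) (φ p)) (hξ : IsUnitNormal 2 h φ ξ)
    (H : M → ℝ) (hH : IsMeanCurvature g h φ ξ H) (humb : IsTotallyUmbilical g h φ)
    (f : M → ℝ) (hf : ContMDiff (𝓡 2) 𝓘(ℝ, ℝ) ∞ f) (hpos : ∀ p, 0 < f p) :
    (IsBiharmonic (conformalMetric g f hf hpos) h φ ↔
      IsTotallyGeodesic g h φ ∨
        ((∀ p, H p ≠ 0) ∧
          (∀ p, tangential g h φ p (ricciOp h (φ p) (ξ p)) = grad g H p) ∧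
          (∀ p, ricci h (φ p) (ξ p) (ξ p) = shapeNormSq g h φ ξ p ∧
            shapeNormSq g h φ ξ p = 2 * H p ^ 2) ∧
          (∀ p, grad g (fun q => f q * H q) p = 0))) ∧
    (((∀ p, H p ≠ 0) ∧
          (∀ p, tangential g h φ p (ricciOp h (φ p) (ξ p)) = grad g H p) ∧
          (∀ p, ricci h (φ p) (ξ p) (ξ p) = shapeNormSq g h φ ξ p ∧
            shapeNormSq g h φ ξ p = 2 * H p ^ 2) ∧
          (∀ p, grad g (fun q => f q * H q) p = 0)) →
      ∃ c : ℝ, 0 < c ∧ ∀ p, f p = c * |H p|⁻¹) ∧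
    (∀ p, tangential g h φ p (ricciOp h (φ p) (ξ p)) = grad g H p) := by
  have S : IsUmbilicalImmersion g h φ ξ H := ⟨hφ, hξ, hH, humb⟩
  refine ⟨⟨fun hb => ?_, ?_⟩, ?_, S.tangential_ricciOp⟩
  · obtain ⟨c, hc⟩ := S.exists_sq_const_of_isBiharmonic hb
    -- As f > 0, the constant value c of (fH)² decides whether H vanishes identically or nowhere.
    rcases eq_or_ne c 0 with rfl | hne
    · left
      rw [S.isTotallyGeodesic_iff]
      intro p
      have h1 : f p * H p = 0 := by simpa using hc p
      exact (mul_eq_zero.mp h1).resolve_left (hpos p).ne'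
    · right
      have hH0 : ∀ p, H p ≠ 0 := by
        intro p h0
        apply hne
        rw [← hc p, h0]
        ring
      have hgrad : ∀ p, grad g (fun q => f q * H q) p = 0 := by
        intro p
        rw [grad_eq_zero_iff]
        ext X
        exact (mul_eq_zero.mp (((S.bitension_eq_zero_iff (hf := hf) (hpos := hpos) p).mp
          (hb p)).2 X)).resolve_left (hH0 p)
      obtain ⟨d, hd⟩ := S.exists_const_of_grad_eq_zero hf hgrad
      refine ⟨hH0, S.tangential_ricciOp, fun p => ⟨?_, S.shapeNormSq_eq p⟩, hgrad⟩
      -- With fH = d constant only d(Ric(ξ,ξ) - 2H²) = 0 is left, and d = f(p)H(p) is nonzero.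
      have h1 := (S.isBiharmonic_iff_of_const hd).mp hb p
      rw [← hd p, mul_eq_zero] at h1
      rw [S.shapeNormSq_eq]
      linarith [h1.resolve_left (mul_ne_zero (hpos p).ne' (hH0 p))]
  · rintro (hT | ⟨-, -, hR, hgrad⟩)
    · rw [S.isTotallyGeodesic_iff] at hT
      exact (S.isBiharmonic_iff_of_const (c := 0) fun p => by rw [hT, mul_zero]).mpr
        fun p => zero_mul _
    · obtain ⟨d, hd⟩ := S.exists_const_of_grad_eq_zero hf hgrad
      refine (S.isBiharmonic_iff_of_const hd).mpr fun p => ?_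
      rw [(hR p).1, (hR p).2, sub_self, mul_zero]
  · rintro ⟨hH0, -, -, hgrad⟩
    obtain ⟨d, hd⟩ := S.exists_const_of_grad_eq_zero hf hgrad
    obtain ⟨p₀⟩ := (inferInstance : Nonempty M)
    -- Since fH = d and f > 0, taking absolute values gives f|H| = |d|.
    refine ⟨|d|, abs_pos.mpr (by rw [← hd p₀]; exact mul_ne_zero (hpos p₀).ne' (hH0 p₀)),
      fun p => ?_⟩
    rw [← hd p, abs_mul, abs_of_pos (hpos p), mul_assoc,
      mul_inv_cancel₀ (abs_ne_zero.mpr (hH0 p)), mul_one]
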